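/- Consider the Gaussian regression model $Y\mid f,X\sim N(f(X),1)$ with $X\sim\mathrm{Unif}[0,1]$, viewed as the exponential family $p_f(y|x)=\exp\{yf(x)-A(f(x))+c(y,x)\}$ with covariate density $\pi\equiv1$ on $[0,1]$; let $m=2$ and let the true regression function $f_0$ belong to the Sobolev space $S^2([0,1])$. Put $V(g,\tilde g)=E\{A''(f_0(X))g(X)\tilde g(X)\}$. An eigen-system $(\varphi_\nu,\rho_\nu)_{\nu\ge1}$ is a listing, in nondecreasing order of $\rho_\nu$ and with multiplicity, of all eigenvalues and corresponding eigenfunctions, normalized by $V(\varphi_\mu,\varphi_\nu)=\delta_{\mu\nu}$, of the boundary value problem $$(-1)^m\varphi^{(2m)}=\rho\,A''(f_0(\cdot))\,\pi(\cdot)\,\varphi\ \text{ on }[0,1],\qquad \varphi^{(j)}(0)=\varphi^{(j)}(1)=0,\quad j=m,\dots,2m-1 .$$ Fix $\beta>1$ and $\sigma_1^2,\sigma_2^2>0$. Put $\tau_\nu^2=\sigma_\nu^{-2}$ and $\gamma_\nu=1$ for $\nu\le 2$, and $\tau_\nu^2=\rho_\nu^{1+\beta/4}$ and $\gamma_\nu=\rho_\nu$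 for $\nu>2$. Let $\lambda=\lambda_n>0$ be such that $h=\lambda^{1/4}$ satisfies $h\asymp n^{-1/(4+\beta)}$ as $n\to\infty$. For a linear functional $F$ and $k\ge1$ let $$\theta_{k,n}^2=\sum_{\nu=1}^\infty\frac{F(\varphi_\nu)^2}{(\tau_\nu^2+n(1+\lambda\gamma_\nu))^k},$$ and say that $F$ satisfies the rate condition with exponent $r$ if, for $k=1,2$, this series converges for every $n\ge1$ and $n^k\theta_{k,n}^2\asymp h^{-r}$ as $n\to\infty$. Then an eigen-system exists, and for every eigen-system: (i) for every $z\in(0,1)$, the evaluation functional $F_z(f)=f(z)$ satisfies the rate condition with $r=1$; (ii) for every $\omega\in L^2([0,1])\setminus\{0\}$, the integral functional $F_\omega(f)=\int_0^1 f(z)\omega(z)\,dz$ satisfies $0<\sum_{\nu=1}^\infty F_\omega(\varphi_\nu)^2<\infty$ and the rate condition with $r=0$. -/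

import Mathlib

open Set MeasureTheory Filter Asymptotics

namespace SplineBvM

noncomputable section

/-- The Sobolev space `S^m([0,1])`: functions whose derivatives of order `j < m` are absolutely
continuous on `[0,1]` and which, together with their `m`-th derivative, are square integrable.
(If `f` is absolutely continuous and its pointwise derivative function is continuous, then `f` is
`C¹`, so the junk value of the derivative at points of non-differentiability is harmless.) -/
def IsSobolev (m : ℕ) (f : ℝ → ℝ) : Prop :=
  MemLp f 2 (volume.restrict (Icc (0 : ℝ) 1)) ∧
  (∀ j < m, AbsolutelyContinuousOnInterval (iteratedDerivWithin j f (Icc 0 1)) 0 1) ∧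
  MemLp (iteratedDerivWithin m f (Icc 0 1)) 2 (volume.restrict (Icc (0 : ℝ) 1))

/-- Conditional density `p_f(y|x) = exp(y f(x) - A(f(x)) + c(y,x))` of the nonparametric
exponential family with log-partition function `A`. -/
def expFamilyDensity (A : ℝ → ℝ) (c : ℝ → ℝ → ℝ) (f : ℝ → ℝ) (x y : ℝ) : ℝ :=
  Real.exp (y * f x - A (f x) + c y x)

/-- The exponential family `(A, c)` is Gaussian regression: for every regression function
`f ∈ S^m([0,1])`, the response given `X = x` is `N(f(x), 1)`. -/
def IsGaussianRegression (m : ℕ) (A : ℝ → ℝ) (c : ℝ → ℝ → ℝ) : Prop :=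
  ∀ f : ℝ → ℝ, IsSobolev m f → ∀ x ∈ Icc (0 : ℝ) 1, ∀ y : ℝ,
    expFamilyDensity A c f x y = ProbabilityTheory.gaussianPDFReal (f x) 1 y

/-- `dens` is the density on `[0,1]` of the uniform distribution. -/
def IsUniformDensity (dens : ℝ → ℝ) : Prop :=
  ∀ x ∈ Icc (0 : ℝ) 1, dens x = 1

/-- `V(g, g') = E{A''(f₀(X)) g(X) g'(X)}`, where `X` has density `dens` on `[0,1]`. -/
def formV (A f₀ dens g g' : ℝ → ℝ) : ℝ :=
  ∫ x in (0 : ℝ)..1, iteratedDeriv 2 A (f₀ x) * g x * g' x * dens x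

/-- `g` is a classical solution on `[0,1]`, for the parameter `r`, of
`(-1)^m g^{(2m)} = r A''(f₀) dens g` with `g^{(j)}(0) = g^{(j)}(1) = 0` for `m ≤ j ≤ 2m-1`. -/
def SolvesEigenproblem (m : ℕ) (A f₀ dens : ℝ → ℝ) (r : ℝ) (g : ℝ → ℝ) : Prop :=
  ContDiffOn ℝ (2 * m : ℕ) g (Icc 0 1) ∧
  (∀ x ∈ Icc (0 : ℝ) 1, (-1) ^ m * iteratedDerivWithin (2 * m) g (Icc 0 1) x
    = r * iteratedDeriv 2 A (f₀ x) * dens x * g x) ∧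
  (∀ j, m ≤ j → j < 2 * m →
    iteratedDerivWithin j g (Icc 0 1) 0 = 0 ∧ iteratedDerivWithin j g (Icc 0 1) 1 = 0)

/-- `(φ, ρ)` is an eigen-system of the boundary value problem: a listing of all its eigenvalues in
nondecreasing order, repeated according to multiplicity, with eigenfunctions that are orthonormal
for `V`. The indices start at `0`, so that `φ 0` and `ρ 0` are the first eigenfunction and the first
eigenvalue. The last field says that the listing is exhaustive: on `[0,1]`, every solution for the
parameter `r` is a linear combination of those `φ ν` that have `ρ ν = r`. -/
structure IsEigenSystem (m : ℕ) (A f₀ dens : ℝ → ℝ) (φ : ℕ → ℝ → ℝ) (ρ : ℕ → ℝ) : Prop where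
  monotone : Monotone ρ
  solves : ∀ ν, SolvesEigenproblem m A f₀ dens (ρ ν) (φ ν)
  orthonormal : ∀ μ ν, formV A f₀ dens (φ μ) (φ ν) = if μ = ν then 1 else 0
  exhaustive : ∀ (r : ℝ) (g : ℝ → ℝ), SolvesEigenproblem m A f₀ dens r g →
    ∃ p ∈ Submodule.span ℝ (φ '' {ν | ρ ν = r}), EqOn g p (Icc 0 1)

/-- The prior precisions: `τ_ν² = 1/σ_ν²` for the first `m` indices and
`τ_ν² = ρ_ν^{1 + β/(2m)}` for the others; `sigSq ν` stands for `σ_ν²`. -/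
def tauSq (m : ℕ) (β : ℝ) (sigSq : ℕ → ℝ) (ρ : ℕ → ℝ) (ν : ℕ) : ℝ :=
  if ν < m then (sigSq ν)⁻¹ else ρ ν ^ (1 + β / (2 * m))

/-- `γ_ν = 1` for the first `m` indices and `γ_ν = ρ_ν` for the others. -/
def gam (m : ℕ) (ρ : ℕ → ℝ) (ν : ℕ) : ℝ :=
  if ν < m then 1 else ρ ν

/-- The `ν`-th term `F(φ_ν)² / (τ_ν² + n(1 + λ γ_ν))^k` of `θ_{k,n}²`, with `λ = lam n`. -/
def thetaTerm (m : ℕ) (β : ℝ) (sigSq : ℕ → ℝ) (lam : ℕ → ℝ) (φ : ℕ → ℝ → ℝ) (ρ : ℕ → ℝ)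
    (F : (ℝ → ℝ) → ℝ) (k n ν : ℕ) : ℝ :=
  F (φ ν) ^ 2 / (tauSq m β sigSq ρ ν + n * (1 + lam n * gam m ρ ν)) ^ k

/-- `θ_{k,n}²`. -/
def thetaSq (m : ℕ) (β : ℝ) (sigSq : ℕ → ℝ) (lam : ℕ → ℝ) (φ : ℕ → ℝ → ℝ) (ρ : ℕ → ℝ)
    (F : (ℝ → ℝ) → ℝ) (k n : ℕ) : ℝ :=
  ∑' ν, thetaTerm m β sigSq lam φ ρ F k n ν

/-- The bandwidth `h = λ^{1/(2m)}`. -/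
def bandwidth (m : ℕ) (lam : ℕ → ℝ) (n : ℕ) : ℝ :=
  lam n ^ (1 / (2 * m : ℝ))

/-- The rate condition `n^k θ_{k,n}² ≍ h^{-r}` as `n → ∞`, for `k = 1, 2`, including the
convergence of the series that define `θ_{k,n}²`. -/
def RateCondition (m : ℕ) (β : ℝ) (sigSq : ℕ → ℝ) (lam : ℕ → ℝ) (φ : ℕ → ℝ → ℝ) (ρ : ℕ → ℝ)
    (F : (ℝ → ℝ) → ℝ) (r : ℝ) : Prop :=
  ∀ k : ℕ, k = 1 ∨ k = 2 →
    (∀ n : ℕ, 1 ≤ n → Summable (thetaTerm m β sigSq lam φ ρ F k n)) ∧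
    (fun n : ℕ => (n : ℝ) ^ k * thetaSq m β sigSq lam φ ρ F k n)
      =Θ[atTop] (fun n : ℕ => bandwidth m lam n ^ (-r))

/-- The evaluation functional `F_z(f) = f(z)`. -/
def evalFunctional (z : ℝ) (f : ℝ → ℝ) : ℝ := f z

/-- The integral functional `F_ω(f) = ∫₀¹ f(z) ω(z) dz`. -/
def integralFunctional (ω : ℝ → ℝ) (f : ℝ → ℝ) : ℝ :=
  ∫ x in (0 : ℝ)..1, f x * ω x

end

end SplineBvM

/-! Since `A'' = 1` and the covariate is uniform, the eigenproblem is that of a free beam: `g'''' =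
r g` with `g'' = g''' = 0` at both ends. No eigenvalue or eigenfunction asymptotics are needed.
Everything rests on two-sided bounds for `K_h(z) = ∑ φ_ν(z)² / (1 + h⁴ ρ_ν)`, the diagonal of the
reproducing kernel for the norm `‖f‖² + h⁴ ‖f''‖²`.

Green's formula gives `∫ f'' φ_ν'' = ρ_ν ∫ f φ_ν` for every `C²` function `f`, so the `φ_ν`
diagonalize both parts of this norm. A Sobolev inequality at scale `h` then yields `K_h(z) ≤ 32/h`
(`sum_sq_div_le`), and a bump of width `h` at `z` yields a lower bound of order `1/h`
(`exists_sum_sq_div_ge`). Comparing with the upper bound at scale `h/40` shows that the indices with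
`ρ_ν ≤ (40/h)⁴` already carry mass of order `1/h` (`exists_sum_sq_ge`).

For evaluation, discarding `τ_ν²` bounds `n^k θ²` by `K_h(z)` plus the first two terms. Conversely,
where `ρ_ν ≤ (40/h)⁴` and `ν ≥ 2` (counting from `0`), `τ_ν² ≤ (40/h)^(4+β)` is of order at most `n`
by the choice of `h`, and `λ ρ_ν` is bounded, so the denominators are of order `n`. For integral
functionals, Bessel's inequality bounds the sum above and one nonzero coefficient bounds it below.

Existence and completeness come from the spectral theorem for the compact symmetric operator `P V⁴
P`, with `V` the Volterra operator and `P` the projection onto the orthogonal complement of the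
affine functions. The upper kernel bound makes the multiplicities and sublevel sets finite, so the
eigenvalues can be listed in order. -/

namespace SplineBvM

/-! ### The Gaussian log-partition function -/

theorem isSobolev_const (a : ℝ) : IsSobolev 2 (fun _ => a) := by
  have h : ∀ j, iteratedDerivWithin j (fun _ : ℝ => a) (Icc 0 1)
      = fun _ => if j = 0 then a else 0 := fun j => by
    funext x; exact iteratedDerivWithin_const
  refine ⟨memLp_const a, fun j _ => ?_, ?_⟩
  · rw [h]; exact contDiffOn_const.absolutelyContinuousOnInterval
  · rw [h]; exact memLp_const _

/-- Constant regression functions suffice: comparing the densities at `x = y = 0` for the constants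
`a` and `0` eliminates `c` and forces `A a = a²/2 + A 0`. -/
theorem IsGaussianRegression.iteratedDeriv_two_eq_one {A : ℝ → ℝ} {c : ℝ → ℝ → ℝ}
    (hA : IsGaussianRegression 2 A c) (t : ℝ) : iteratedDeriv 2 A t = 1 := by
  have key : ∀ a : ℝ, A a = a ^ 2 / 2 + A 0 := fun a => by
    have h1 := hA _ (isSobolev_const a) 0 (by simp) 0
    have h2 := hA _ (isSobolev_const 0) 0 (by simp) 0
    simp only [expFamilyDensity, ProbabilityTheory.gaussianPDFReal] at h1 h2
    have h3 : Real.exp (0 * a - A a + c 0 0) = Real.exp (0 * 0 - A 0 + c 0 0 - a ^ 2 / 2) := by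
      rw [Real.exp_sub (0 * 0 - A 0 + c 0 0), h1, h2, mul_div_assoc, ← Real.exp_sub]
      simp only [NNReal.coe_one]
      ring_nf
    have := Real.exp_injective h3
    linarith
  have hfun : A = fun a => a ^ 2 / 2 + A 0 := funext key
  have hd : deriv A = fun a => a := by
    funext a
    rw [hfun]
    have : HasDerivAt (fun a : ℝ => a ^ 2 / 2 + A 0) (((2 : ℕ) * a ^ (2 - 1)) / 2) a :=
      ((hasDerivAt_pow 2 a).div_const 2).add_const _
    rw [this.deriv]; norm_num
  rw [show (2 : ℕ) = 1 + 1 from rfl, iteratedDeriv_succ, iteratedDeriv_one, hd]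
  simp

/-! ### Free beam solutions and Green's formula -/

/-- `f` is twice continuously differentiable on `[0,1]`, with derivatives `f₁` and `f₂`. -/
structure HasTwoDerivs (f f₁ f₂ : ℝ → ℝ) : Prop where
  deriv₁ : ∀ x ∈ Icc (0 : ℝ) 1, HasDerivWithinAt f (f₁ x) (Icc 0 1) x
  deriv₂ : ∀ x ∈ Icc (0 : ℝ) 1, HasDerivWithinAt f₁ (f₂ x) (Icc 0 1) x
  cont₂ : ContinuousOn f₂ (Icc 0 1)

/-- `g` solves `g'''' = r g` with `g'' = g''' = 0` at both ends; `g₁`, `g₂`, `g₃` are its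
derivatives. -/
structure IsFreeBeam (r : ℝ) (g g₁ g₂ g₃ : ℝ → ℝ) : Prop where
  deriv₁ : ∀ x ∈ Icc (0 : ℝ) 1, HasDerivWithinAt g (g₁ x) (Icc 0 1) x
  deriv₂ : ∀ x ∈ Icc (0 : ℝ) 1, HasDerivWithinAt g₁ (g₂ x) (Icc 0 1) x
  deriv₃ : ∀ x ∈ Icc (0 : ℝ) 1, HasDerivWithinAt g₂ (g₃ x) (Icc 0 1) x
  deriv₄ : ∀ x ∈ Icc (0 : ℝ) 1, HasDerivWithinAt g₃ (r * g x) (Icc 0 1) x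
  zero₂ : g₂ 0 = 0
  one₂ : g₂ 1 = 0
  zero₃ : g₃ 0 = 0
  one₃ : g₃ 1 = 0

theorem continuousOn_of_deriv {f f' : ℝ → ℝ}
    (h : ∀ x ∈ Icc (0 : ℝ) 1, HasDerivWithinAt f (f' x) (Icc 0 1) x) : ContinuousOn f (Icc 0 1) :=
  fun x hx => (h x hx).continuousWithinAt

theorem intervalIntegrable_unit {f : ℝ → ℝ} (h : ContinuousOn f (Icc 0 1)) :
    IntervalIntegrable f volume 0 1 :=
  ContinuousOn.intervalIntegrable (by rwa [uIcc_of_le zero_le_one])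

namespace HasTwoDerivs
variable {f f₁ f₂ g g₁ g₂ : ℝ → ℝ}

theorem cont (h : HasTwoDerivs f f₁ f₂) : ContinuousOn f (Icc 0 1) := continuousOn_of_deriv h.deriv₁
theorem cont₁ (h : HasTwoDerivs f f₁ f₂) : ContinuousOn f₁ (Icc 0 1) :=
  continuousOn_of_deriv h.deriv₂

theorem sub (hf : HasTwoDerivs f f₁ f₂) (hg : HasTwoDerivs g g₁ g₂) :
    HasTwoDerivs (f - g) (f₁ - g₁) (f₂ - g₂) :=
  ⟨fun x hx => (hf.deriv₁ x hx).sub (hg.deriv₁ x hx),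
    fun x hx => (hf.deriv₂ x hx).sub (hg.deriv₂ x hx), hf.cont₂.sub hg.cont₂⟩

theorem sum {ι : Type*} {φ φ₁ φ₂ : ι → ℝ → ℝ} (h : ∀ i, HasTwoDerivs (φ i) (φ₁ i) (φ₂ i))
    (a : ι → ℝ) (S : Finset ι) :
    HasTwoDerivs (∑ i ∈ S, a i • φ i) (∑ i ∈ S, a i • φ₁ i) (∑ i ∈ S, a i • φ₂ i) := by
  refine ⟨fun x hx => ?_, fun x hx => ?_, ?_⟩
  · rw [Finset.sum_apply]
    exact HasDerivWithinAt.sum fun i _ => ((h i).deriv₁ x hx).const_smul (a i)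
  · rw [Finset.sum_apply]
    exact HasDerivWithinAt.sum fun i _ => ((h i).deriv₂ x hx).const_smul (a i)
  · have := continuousOn_finsetSum S fun i _ => ((h i).cont₂).const_smul (a i)
    refine this.congr fun x _ => ?_
    simp

end HasTwoDerivs

namespace IsFreeBeam
variable {r s : ℝ} {f f₁ f₂ g g₁ g₂ g₃ k k₁ k₂ k₃ : ℝ → ℝ}

theorem hasTwoDerivs (h : IsFreeBeam r g g₁ g₂ g₃) : HasTwoDerivs g g₁ g₂ :=
  ⟨h.deriv₁, h.deriv₂, continuousOn_of_deriv h.deriv₃⟩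

theorem cont (h : IsFreeBeam r g g₁ g₂ g₃) : ContinuousOn g (Icc 0 1) := h.hasTwoDerivs.cont

/-- Green's formula: the free boundary conditions are natural. -/
theorem integral_second_deriv_mul (hf : HasTwoDerivs f f₁ f₂) (hg : IsFreeBeam r g g₁ g₂ g₃) :
    ∫ x in (0 : ℝ)..1, f₂ x * g₂ x = r * ∫ x in (0 : ℝ)..1, f x * g x := by
  have hu : uIcc (0 : ℝ) 1 = Icc 0 1 := uIcc_of_le zero_le_one
  have c3 : ContinuousOn g₃ (Icc 0 1) := continuousOn_of_deriv hg.deriv₄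
  have e1 := intervalIntegral.integral_mul_deriv_eq_deriv_mul_of_hasDerivWithinAt
    (a := 0) (b := 1) (u := g₂) (v := f₁) (u' := g₃) (v' := f₂)
    (by rw [hu]; exact hg.deriv₃) (by rw [hu]; exact hf.deriv₂)
    (intervalIntegrable_unit c3) (intervalIntegrable_unit hf.cont₂)
  have e2 := intervalIntegral.integral_mul_deriv_eq_deriv_mul_of_hasDerivWithinAt
    (a := 0) (b := 1) (u := g₃) (v := f) (u' := fun x => r * g x) (v' := f₁)
    (by rw [hu]; exact hg.deriv₄) (by rw [hu]; exact hf.deriv₁)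
    (intervalIntegrable_unit (continuousOn_const.mul hg.cont)) (intervalIntegrable_unit hf.cont₁)
  rw [hg.zero₂, hg.one₂] at e1
  rw [hg.zero₃, hg.one₃] at e2
  calc ∫ x in (0 : ℝ)..1, f₂ x * g₂ x = ∫ x in (0 : ℝ)..1, g₂ x * f₂ x := by simp_rw [mul_comm]
    _ = ∫ x in (0 : ℝ)..1, r * g x * f x := by rw [e1, e2]; ring
    _ = r * ∫ x in (0 : ℝ)..1, f x * g x := by
        rw [← intervalIntegral.integral_const_mul]; congr 1; funext x; ring

/-- Green's formula evaluates the symmetric quantity `∫ g'' k''` both as `r ∫ g k` and as `s ∫ g k`.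
-/
theorem integral_mul_eq_zero (hg : IsFreeBeam r g g₁ g₂ g₃) (hk : IsFreeBeam s k k₁ k₂ k₃)
    (hrs : r ≠ s) : ∫ x in (0 : ℝ)..1, g x * k x = 0 := by
  have h1 := integral_second_deriv_mul hg.hasTwoDerivs hk
  have h2 := integral_second_deriv_mul hk.hasTwoDerivs hg
  simp_rw [mul_comm (k₂ _), mul_comm (k _)] at h2
  have : (r - s) * ∫ x in (0 : ℝ)..1, g x * k x = 0 := by rw [sub_mul]; linarith
  exact (mul_eq_zero.1 this).resolve_left (sub_ne_zero.2 hrs)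

theorem nonneg (hg : IsFreeBeam r g g₁ g₂ g₃) (h1 : ∫ x in (0 : ℝ)..1, g x * g x = 1) : 0 ≤ r := by
  have h := integral_second_deriv_mul hg.hasTwoDerivs hg
  rw [h1, mul_one] at h
  rw [← h]
  exact intervalIntegral.integral_nonneg zero_le_one fun x _ => mul_self_nonneg _

end IsFreeBeam

/-! ### Sobolev inequalities -/

theorem sq_integral_le {u : ℝ → ℝ} (hu : ContinuousOn u (Icc 0 1)) :
    (∫ x in (0 : ℝ)..1, u x) ^ 2 ≤ ∫ x in (0 : ℝ)..1, u x ^ 2 := by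
  set m := ∫ x in (0 : ℝ)..1, u x with hm
  have h0 : 0 ≤ ∫ x in (0 : ℝ)..1, (u x - m) ^ 2 :=
    intervalIntegral.integral_nonneg zero_le_one fun x _ => sq_nonneg _
  have e : ∀ x, (u x - m) ^ 2 = u x ^ 2 - 2 * m * u x + m ^ 2 := fun x => by ring
  simp_rw [e] at h0
  rw [intervalIntegral.integral_add, intervalIntegral.integral_sub,
    intervalIntegral.integral_const_mul, ← hm] at h0
  · simp at h0; nlinarith
  · exact intervalIntegrable_unit (hu.pow 2)
  · exact (intervalIntegrable_unit hu).const_mul _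
  · exact (intervalIntegrable_unit (hu.pow 2)).sub ((intervalIntegrable_unit hu).const_mul _)
  · exact intervalIntegrable_const

/-- Integrate `w f''` by parts twice with `w(t) = t(1-t)²`. Since `w(0) = w(1) = w'(1) = 0` and
`w'(0) = 1`, this leaves `f 0 = ∫ w f'' - ∫ w'' f`, where `|w| ≤ 1` and `|w''| ≤ 4` on the interval.
-/
theorem HasTwoDerivs.sq_zero_le {f f₁ f₂ : ℝ → ℝ} (hf : HasTwoDerivs f f₁ f₂) :
    f 0 ^ 2 ≤ 32 * ((∫ x in (0 : ℝ)..1, f x ^ 2) + ∫ x in (0 : ℝ)..1, f₂ x ^ 2) := by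
  have hu : uIcc (0 : ℝ) 1 = Icc 0 1 := uIcc_of_le zero_le_one
  have d1 : ∀ x : ℝ, HasDerivAt (fun t : ℝ => t * (1 - t) ^ 2) (1 - 4 * x + 3 * x ^ 2) x := fun x => by
    have := (hasDerivAt_id x).mul (((hasDerivAt_id x).const_sub 1).pow 2)
    convert! this using 1
    simp; ring
  have d2 : ∀ x : ℝ, HasDerivAt (fun t : ℝ => 1 - 4 * t + 3 * t ^ 2) (-4 + 6 * x) x := fun x => by
    have := (((hasDerivAt_id x).const_mul 4).const_sub 1).add (((hasDerivAt_id x).pow 2).const_mul 3)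
    convert! this using 1
    simp; ring
  have e1 := intervalIntegral.integral_mul_deriv_eq_deriv_mul_of_hasDerivWithinAt
    (a := 0) (b := 1) (u := fun t : ℝ => t * (1 - t) ^ 2) (v := f₁)
    (u' := fun t : ℝ => 1 - 4 * t + 3 * t ^ 2) (v' := f₂)
    (fun x _ => (d1 x).hasDerivWithinAt) (by rw [hu]; exact hf.deriv₂)
    (intervalIntegrable_unit (by fun_prop)) (intervalIntegrable_unit hf.cont₂)
  have e2 := intervalIntegral.integral_mul_deriv_eq_deriv_mul_of_hasDerivWithinAt
    (a := 0) (b := 1) (u := fun t : ℝ => 1 - 4 * t + 3 * t ^ 2) (v := f)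
    (u' := fun t : ℝ => -4 + 6 * t) (v' := f₁)
    (fun x _ => (d2 x).hasDerivWithinAt) (by rw [hu]; exact hf.deriv₁)
    (intervalIntegrable_unit (by fun_prop)) (intervalIntegrable_unit hf.cont₁)
  have c1 : ContinuousOn (fun x => x * (1 - x) ^ 2 * f₂ x) (Icc 0 1) :=
    ContinuousOn.mul (by fun_prop) hf.cont₂
  have c2 : ContinuousOn (fun x => (-4 + 6 * x) * f x) (Icc 0 1) :=
    ContinuousOn.mul (by fun_prop) hf.cont
  have b1 : (∫ x in (0 : ℝ)..1, x * (1 - x) ^ 2 * f₂ x) ^ 2 ≤ ∫ x in (0 : ℝ)..1, f₂ x ^ 2 := by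
    refine (sq_integral_le c1).trans (intervalIntegral.integral_mono_on zero_le_one
      (intervalIntegrable_unit (c1.pow 2)) (intervalIntegrable_unit (hf.cont₂.pow 2)) fun x hx => ?_)
    rw [mul_pow]
    have h0 : 0 ≤ x * (1 - x) ^ 2 := mul_nonneg hx.1 (sq_nonneg _)
    have h1 : x * (1 - x) ^ 2 ≤ 1 := by
      have : (1 - x) ^ 2 ≤ 1 := by nlinarith [hx.1, hx.2]
      nlinarith [hx.1, hx.2, sq_nonneg (1 - x)]
    have h2 : (x * (1 - x) ^ 2) ^ 2 ≤ 1 := pow_le_one₀ h0 h1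
    nlinarith [sq_nonneg (f₂ x)]
  have b2 : (∫ x in (0 : ℝ)..1, (-4 + 6 * x) * f x) ^ 2 ≤ 16 * ∫ x in (0 : ℝ)..1, f x ^ 2 := by
    rw [← intervalIntegral.integral_const_mul]
    refine (sq_integral_le c2).trans (intervalIntegral.integral_mono_on zero_le_one
      (intervalIntegrable_unit (c2.pow 2))
      (intervalIntegrable_unit (continuousOn_const.mul (hf.cont.pow 2))) fun x hx => ?_)
    rw [mul_pow]
    have h2 : (-4 + 6 * x) ^ 2 ≤ 16 := by nlinarith [hx.1, hx.2]
    nlinarith [sq_nonneg (f x)]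
  have n2 : 0 ≤ ∫ x in (0 : ℝ)..1, f₂ x ^ 2 :=
    intervalIntegral.integral_nonneg zero_le_one fun x _ => sq_nonneg _
  have key : f 0 = (∫ x in (0 : ℝ)..1, x * (1 - x) ^ 2 * f₂ x)
      - ∫ x in (0 : ℝ)..1, (-4 + 6 * x) * f x := by
    rw [e1, e2]; norm_num
  rw [key]
  generalize (∫ x in (0 : ℝ)..1, x * (1 - x) ^ 2 * f₂ x) = p at *
  generalize (∫ x in (0 : ℝ)..1, (-4 + 6 * x) * f x) = q at *
  nlinarith [sq_nonneg (p + q)]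

/-- A Sobolev inequality with a bandwidth. -/
theorem HasTwoDerivs.sq_le {f f₁ f₂ : ℝ → ℝ} (hf : HasTwoDerivs f f₁ f₂) {z h : ℝ}
    (hz : z ∈ Icc (0 : ℝ) 1) (h0 : 0 < h) (h1 : h ≤ 1 / 2) :
    f z ^ 2 ≤ 32 / h * ((∫ x in (0 : ℝ)..1, f x ^ 2) + h ^ 4 * ∫ x in (0 : ℝ)..1, f₂ x ^ 2) := by
  -- Rescale an interval of length `h` with endpoint `z` to the unit interval, going towards the
  -- farther end so that `h ≤ 1/2` keeps it inside. The chain rule produces the factor `h⁴` and the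
  -- change of variables the factor `1/h`.
  obtain ⟨s, hs, hmaps⟩ : ∃ s : ℝ, (s = h ∨ s = -h) ∧ ∀ t ∈ Icc (0 : ℝ) 1, z + s * t ∈ Icc (0 : ℝ) 1 := by
    rcases le_total z (1 / 2) with hz2 | hz2
    · refine ⟨h, Or.inl rfl, fun t ht => ⟨?_, ?_⟩⟩
      · nlinarith [ht.1, hz.1]
      · nlinarith [ht.1, ht.2, hz.1]
    · refine ⟨-h, Or.inr rfl, fun t ht => ⟨?_, ?_⟩⟩
      · nlinarith [ht.1, ht.2, hz.1]
      · nlinarith [ht.1, hz.2]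
  have hs0 : s ≠ 0 := by rcases hs with rfl | rfl <;> simp [h0.ne']
  have hin : ∀ t : ℝ, HasDerivWithinAt (fun t => z + s * t) s (Icc 0 1) t := fun t => by
    have := (((hasDerivAt_id t).const_mul s).const_add z).hasDerivWithinAt (s := Icc 0 1)
    simpa using this
  have hc : ContinuousOn (fun t => z + s * t) (Icc 0 1) := by fun_prop
  have hG : HasTwoDerivs (fun t => f (z + s * t)) (fun t => f₁ (z + s * t) * s)
      (fun t => f₂ (z + s * t) * s * s) := by
    refine ⟨fun t ht => ?_, fun t ht => ?_, ?_⟩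
    · exact (hf.deriv₁ _ (hmaps t ht)).comp t (hin t) hmaps
    · exact ((hf.deriv₂ _ (hmaps t ht)).comp t (hin t) hmaps).mul_const s
    · exact ((hf.cont₂.comp hc hmaps).mul continuousOn_const).mul continuousOn_const
  have hI : ∀ u : ℝ → ℝ, ContinuousOn u (Icc 0 1) →
      ∫ t in (0 : ℝ)..1, u (z + s * t) ^ 2 ≤ h⁻¹ * ∫ x in (0 : ℝ)..1, u x ^ 2 := fun u hu => by
    rw [intervalIntegral.integral_comp_add_mul (fun x => u x ^ 2) hs0, smul_eq_mul, mul_zero, add_zero,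
      mul_one]
    have hint := intervalIntegrable_unit (hu.pow 2)
    have hnn : 0 ≤ᵐ[volume.restrict (Ioc (0 : ℝ) 1)] fun x => u x ^ 2 :=
      Eventually.of_forall fun x => sq_nonneg _
    have hm := hmaps 1 (by simp)
    rw [mul_one] at hm
    rcases hs with rfl | rfl
    · exact mul_le_mul_of_nonneg_left (intervalIntegral.integral_mono_interval hz.1 (by linarith)
        hm.2 hnn hint) (by positivity)
    · rw [intervalIntegral.integral_symm, inv_neg, neg_mul_neg]
      exact mul_le_mul_of_nonneg_left (intervalIntegral.integral_mono_interval hm.1 (by linarith)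
        hz.2 hnn hint) (by positivity)
  have hss : s * s = h ^ 2 := by rcases hs with rfl | rfl <;> ring
  have key := hG.sq_zero_le
  have e2 : ∫ t in (0 : ℝ)..1, (f₂ (z + s * t) * s * s) ^ 2
      = h ^ 4 * ∫ t in (0 : ℝ)..1, f₂ (z + s * t) ^ 2 := by
    rw [← intervalIntegral.integral_const_mul]; congr 1; funext t
    rw [mul_assoc, hss]; ring
  rw [e2] at key
  simp only [mul_zero, add_zero] at key
  have a1 := hI f hf.cont
  have a2 := mul_le_mul_of_nonneg_left (hI f₂ hf.cont₂) (by positivity : 0 ≤ h ^ 4)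
  calc f z ^ 2 ≤ _ := key
    _ ≤ 32 * (h⁻¹ * (∫ x in (0 : ℝ)..1, f x ^ 2) + h ^ 4 * (h⁻¹ * ∫ x in (0 : ℝ)..1, f₂ x ^ 2)) := by
        linarith
    _ = _ := by rw [div_eq_mul_inv]; ring

/-! ### The boundary value problem in terms of explicit derivatives -/

theorem solvesEigenproblem_iff {A f₀ dens : ℝ → ℝ} (hA : ∀ t, iteratedDeriv 2 A t = 1)
    (hd : IsUniformDensity dens) {r : ℝ} {g : ℝ → ℝ} :
    SolvesEigenproblem 2 A f₀ dens r g ↔ ∃ g₁ g₂ g₃, IsFreeBeam r g g₁ g₂ g₃ := by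
  have hU : UniqueDiffOn ℝ (Icc (0 : ℝ) 1) := uniqueDiffOn_Icc zero_lt_one
  set D : ℕ → ℝ → ℝ := fun j => iteratedDerivWithin j g (Icc 0 1) with hD
  have hD0 : D 0 = g := iteratedDerivWithin_zero
  constructor
  · rintro ⟨h1, h2, h3⟩
    have hder : ∀ j : ℕ, j < 4 → ∀ x ∈ Icc (0 : ℝ) 1,
        HasDerivWithinAt (D j) (D (j + 1) x) (Icc 0 1) x := fun j hj x hx => by
      have := h1.differentiableOn_iteratedDerivWithin (m := j) (by exact_mod_cast hj) hU x hx
      simp only [hD, iteratedDerivWithin_succ]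
      exact this.hasDerivWithinAt
    refine ⟨D 1, D 2, D 3, ?_, hder 1 (by norm_num), hder 2 (by norm_num), fun x hx => ?_,
      (h3 2 le_rfl (by norm_num)).1, (h3 2 le_rfl (by norm_num)).2,
      (h3 3 (by norm_num) (by norm_num)).1, (h3 3 (by norm_num) (by norm_num)).2⟩
    · have := hder 0 (by norm_num); rwa [hD0] at this
    · have := hder 3 (by norm_num) x hx
      have e := h2 x hx
      rw [hA, hd x hx] at e
      norm_num at e
      rwa [← e]
  · rintro ⟨g₁, g₂, g₃, h⟩
    have step : ∀ (j : ℕ) (u v : ℝ → ℝ), EqOn (D j) u (Icc 0 1) →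
        (∀ x ∈ Icc (0 : ℝ) 1, HasDerivWithinAt u (v x) (Icc 0 1) x) →
        EqOn (D (j + 1)) v (Icc 0 1) ∧ DifferentiableOn ℝ (D j) (Icc 0 1) := by
      intro j u v he hv
      have hv' : ∀ x ∈ Icc (0 : ℝ) 1, HasDerivWithinAt (D j) (v x) (Icc 0 1) x :=
        fun x hx => (hv x hx).congr he (he hx)
      refine ⟨fun x hx => ?_, fun x hx => (hv' x hx).differentiableWithinAt⟩
      simp only [hD, iteratedDerivWithin_succ]
      exact (hv' x hx).derivWithin (hU x hx)
    have s0 := step 0 g g₁ (by rw [hD0]; exact fun x _ => rfl) h.deriv₁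
    have s1 := step 1 g₁ g₂ s0.1 h.deriv₂
    have s2 := step 2 g₂ g₃ s1.1 h.deriv₃
    have s3 := step 3 g₃ _ s2.1 h.deriv₄
    refine ⟨?_, fun x hx => ?_, fun j hj hj' => ?_⟩
    · refine contDiffOn_of_continuousOn_differentiableOn_deriv (n := ((4 : ℕ) : ℕ∞)) ?_ ?_
      · intro m hm
        have hm : m ≤ 4 := by exact_mod_cast hm
        interval_cases m
        · exact s0.2.continuousOn
        · exact s1.2.continuousOn
        · exact s2.2.continuousOn
        · exact s3.2.continuousOn
        · exact (continuousOn_const.mul h.cont).congr s3.1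
      · intro m hm
        have hm : m < 4 := by exact_mod_cast hm
        interval_cases m
        · exact s0.2
        · exact s1.2
        · exact s2.2
        · exact s3.2
    · rw [hA, hd x hx]
      have := s3.1 hx
      simp only [hD] at this
      norm_num
      exact this
    · have z : (0 : ℝ) ∈ Icc (0 : ℝ) 1 := by simp
      have o : (1 : ℝ) ∈ Icc (0 : ℝ) 1 := by simp
      have : j = 2 ∨ j = 3 := by omega
      rcases this with rfl | rfl
      · exact ⟨(s1.1 z).trans h.zero₂, (s1.1 o).trans h.one₂⟩
      · exact ⟨(s2.1 z).trans h.zero₃, (s2.1 o).trans h.one₃⟩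

/-! ### The Volterra operator on L² -/

open scoped InnerProductSpace Topology

/-- Lebesgue measure on `[0,1]`. -/
noncomputable abbrev unitMeasure : Measure ℝ := volume.restrict (Icc (0 : ℝ) 1)

/-- The Hilbert space `L²([0,1])`. -/
abbrev L2Unit : Type := Lp ℝ 2 unitMeasure

open scoped Classical in
/-- The class in `L²([0,1])` of a square integrable function (and `0` for other functions). -/
noncomputable def l2 (f : ℝ → ℝ) : L2Unit :=
  if h : MemLp f 2 unitMeasure then h.toLp f else 0

theorem coeFn_l2 {f : ℝ → ℝ} (h : MemLp f 2 unitMeasure) : l2 f =ᵐ[unitMeasure] f := by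
  rw [l2, dif_pos h]; exact h.coeFn_toLp

theorem eq_l2_of_ae {u : L2Unit} {f : ℝ → ℝ} (h : u =ᵐ[unitMeasure] f) : u = l2 f := by
  have hf : MemLp f 2 unitMeasure := (memLp_congr_ae h).1 (Lp.memLp u)
  exact Lp.ext (h.trans (coeFn_l2 hf).symm)

theorem l2_congr {f g : ℝ → ℝ} (hf : MemLp f 2 unitMeasure) (h : EqOn f g (Icc 0 1)) :
    l2 f = l2 g :=
  eq_l2_of_ae ((coeFn_l2 hf).trans (ae_restrict_of_forall_mem measurableSet_Icc h))

theorem memLp_of_continuousOn {f : ℝ → ℝ} (h : ContinuousOn f (Icc 0 1)) :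
    MemLp f 2 unitMeasure := by
  obtain ⟨C, hC⟩ := isCompact_Icc.exists_bound_of_continuousOn h
  exact MemLp.of_bound (h.aestronglyMeasurable measurableSet_Icc) C
    (ae_restrict_of_forall_mem measurableSet_Icc hC)

theorem integral_unitMeasure (f : ℝ → ℝ) : ∫ x, f x ∂unitMeasure = ∫ x in (0 : ℝ)..1, f x := by
  rw [intervalIntegral.integral_of_le zero_le_one, integral_Icc_eq_integral_Ioc]

theorem inner_eq_integral (u v : L2Unit) : ⟪u, v⟫_ℝ = ∫ x in (0 : ℝ)..1, u x * v x := by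
  rw [L2.inner_def, integral_unitMeasure]
  congr 1; funext x; simp [mul_comm]

theorem intervalIntegral_congr_unit {f g : ℝ → ℝ} (h : f =ᵐ[unitMeasure] g) {a b : ℝ}
    (ha : a ∈ Icc (0 : ℝ) 1) (hb : b ∈ Icc (0 : ℝ) 1) : ∫ x in a..b, f x = ∫ x in a..b, g x := by
  refine intervalIntegral.integral_congr_ae ?_
  filter_upwards [(ae_restrict_iff' measurableSet_Icc).1 h] with x hx hx'
  exact hx ⟨(le_min ha.1 hb.1).trans hx'.1.le, hx'.2.trans (max_le ha.2 hb.2)⟩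

theorem inner_l2 {f g : ℝ → ℝ} (hf : MemLp f 2 unitMeasure) (hg : MemLp g 2 unitMeasure) :
    ⟪l2 f, l2 g⟫_ℝ = ∫ x in (0 : ℝ)..1, f x * g x := by
  rw [inner_eq_integral]
  exact intervalIntegral_congr_unit ((coeFn_l2 hf).mul (coeFn_l2 hg)) (by simp) (by simp)

theorem l2_add {f g : ℝ → ℝ} (hf : MemLp f 2 unitMeasure) (hg : MemLp g 2 unitMeasure) :
    l2 (f + g) = l2 f + l2 g :=
  (eq_l2_of_ae ((Lp.coeFn_add _ _).trans ((coeFn_l2 hf).add (coeFn_l2 hg)))).symm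

theorem l2_sub {f g : ℝ → ℝ} (hf : MemLp f 2 unitMeasure) (hg : MemLp g 2 unitMeasure) :
    l2 (f - g) = l2 f - l2 g :=
  (eq_l2_of_ae ((Lp.coeFn_sub _ _).trans ((coeFn_l2 hf).sub (coeFn_l2 hg)))).symm

theorem l2_smul (a : ℝ) {f : ℝ → ℝ} (hf : MemLp f 2 unitMeasure) : l2 (a • f) = a • l2 f :=
  (eq_l2_of_ae ((Lp.coeFn_smul _ _).trans ((coeFn_l2 hf).const_smul a))).symm

theorem l2_sum {ι : Type*} {φ : ι → ℝ → ℝ} (hφ : ∀ i, MemLp (φ i) 2 unitMeasure) (a : ι → ℝ)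
    (S : Finset ι) : l2 (∑ i ∈ S, a i • φ i) = ∑ i ∈ S, a i • l2 (φ i) := by
  classical
  induction S using Finset.induction_on with
  | empty =>
    have h : MemLp (0 : ℝ → ℝ) 2 unitMeasure := MemLp.zero
    simpa using l2_smul 0 h
  | insert i S hi ih =>
    rw [Finset.sum_insert hi, Finset.sum_insert hi, l2_add ((hφ i).const_smul _), ih,
      l2_smul _ (hφ i)]
    exact memLp_finsetSum' S fun j _ => (hφ j).const_smul _

theorem intervalIntegrable_coe (u : L2Unit) : IntervalIntegrable u volume 0 1 := by
  rw [intervalIntegrable_iff_integrableOn_Icc_of_le zero_le_one]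
  exact (Lp.memLp u).integrable one_le_two

/-- The class of the indicator function of `(x, y]`. -/
noncomputable def indIoc (x y : ℝ) : L2Unit :=
  indicatorConstLp 2 (measurableSet_Ioc : MeasurableSet (Ioc x y)) (measure_ne_top _ _) (1 : ℝ)

theorem inner_indIoc {x y : ℝ} (hx : 0 ≤ x) (hxy : x ≤ y) (hy : y ≤ 1) (u : L2Unit) :
    ⟪indIoc x y, u⟫_ℝ = ∫ t in x..y, u t := by
  rw [indIoc, L2.inner_indicatorConstLp_one, intervalIntegral.integral_of_le hxy,
    Measure.restrict_restrict measurableSet_Ioc, inter_eq_self_of_subset_left]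
  exact fun t ht => ⟨hx.trans ht.1.le, ht.2.trans hy⟩

theorem norm_indIoc_le (x y : ℝ) : ‖indIoc x y‖ ≤ √(y - x) := by
  rw [indIoc, norm_indicatorConstLp (by norm_num) (by norm_num), norm_one, one_mul,
    ENNReal.toReal_ofNat, ← Real.sqrt_eq_rpow]
  rcases le_total x y with h | h
  · refine Real.sqrt_le_sqrt ?_
    calc unitMeasure.real (Ioc x y) ≤ volume.real (Ioc x y) :=
          ENNReal.toReal_mono (by simp) (Measure.restrict_apply_le _ _)
      _ = y - x := by simp [h]
  · simp [Ioc_eq_empty (not_lt.2 h)]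

theorem abs_integral_sub_le (u : L2Unit) {x y : ℝ} (hx : x ∈ Icc (0 : ℝ) 1)
    (hy : y ∈ Icc (0 : ℝ) 1) :
    |(∫ t in (0 : ℝ)..x, u t) - ∫ t in (0 : ℝ)..y, u t| ≤ √|x - y| * ‖u‖ := by
  wlog h : y ≤ x generalizing x y
  · rw [abs_sub_comm, abs_sub_comm x]; exact this hy hx (le_of_not_ge h)
  have hi : ∀ z ∈ Icc (0 : ℝ) 1, IntervalIntegrable u volume 0 z := fun z hz =>
    (intervalIntegrable_coe u).mono_set (by
      rw [uIcc_of_le hz.1, uIcc_of_le zero_le_one]; exact Icc_subset_Icc_right hz.2)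
  rw [intervalIntegral.integral_interval_sub_left (hi x hx) (hi y hy), abs_of_nonneg (sub_nonneg.2 h),
    ← inner_indIoc hy.1 h hx.2]
  exact (abs_real_inner_le_norm _ _).trans
    (mul_le_mul_of_nonneg_right (norm_indIoc_le _ _) (norm_nonneg _))

/-- Integration from `0`, as a map from `L²([0,1])` to continuous functions on `[0,1]`. -/
noncomputable def primitiveBCF : L2Unit →L[ℝ] BoundedContinuousFunction (Icc (0 : ℝ) 1) ℝ :=
  LinearMap.mkContinuous
    { toFun := fun u => BoundedContinuousFunction.mkOfCompact
        -- Writing the primitive as a pairing with an indicator makes linearity immediate and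
        -- reduces its bounds to Cauchy–Schwarz.
        ⟨fun x => ⟪indIoc 0 x, u⟫_ℝ, by
          have h : ContinuousOn (fun x : ℝ => ∫ t in (0 : ℝ)..x, u t) (Icc 0 1) := by
            have := intervalIntegral.continuousOn_primitive_interval (μ := volume) (f := u)
              (a := 0) (b := 1) (by
                rw [uIcc_of_le zero_le_one]; exact (Lp.memLp u).integrable one_le_two)
            rwa [uIcc_of_le zero_le_one] at this
          refine h.domRestrict.congr fun x => ?_
          exact (inner_indIoc le_rfl x.2.1 x.2.2 u).symm⟩
      map_add' := fun u v => by ext x; simp [inner_add_right]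
      map_smul' := fun a u => by ext x; simp [inner_smul_right] }
    1 (fun u => by
      rw [one_mul]
      refine (BoundedContinuousFunction.norm_le (norm_nonneg _)).2 fun x => ?_
      refine (abs_real_inner_le_norm (indIoc 0 x) u).trans
        (mul_le_of_le_one_left (norm_nonneg _) ((norm_indIoc_le _ _).trans ?_))
      rw [Real.sqrt_le_one]
      linarith [x.2.2])

theorem primitiveBCF_apply (u : L2Unit) (x : Icc (0 : ℝ) 1) :
    primitiveBCF u x = ∫ t in (0 : ℝ)..x, u t :=
  inner_indIoc le_rfl x.2.1 x.2.2 u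

/-- Arzelà–Ascoli: primitives of the unit ball are bounded by `1` and share the Hölder modulus `√t`.
-/
theorem isCompactOperator_primitiveBCF : IsCompactOperator primitiveBCF := by
  refine (isCompactOperator_iff_isCompact_closure_image_closedBall
    (primitiveBCF : L2Unit →ₗ[ℝ] BoundedContinuousFunction (Icc (0 : ℝ) 1) ℝ) zero_lt_one).2 ?_
  refine BoundedContinuousFunction.arzela_ascoli (Metric.closedBall 0 1)
    (isCompact_closedBall _ _) _ ?_ ?_
  · rintro _ x ⟨u, hu, rfl⟩
    have hu : ‖u‖ ≤ 1 := by simpa using hu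
    have h := abs_integral_sub_le u x.2 (show (0 : ℝ) ∈ Icc (0 : ℝ) 1 by simp)
    have hx : √|(x : ℝ) - 0| ≤ 1 := by
      rw [Real.sqrt_le_one, sub_zero, abs_of_nonneg x.2.1]; exact x.2.2
    rw [intervalIntegral.integral_same, sub_zero, ← primitiveBCF_apply] at h
    simpa using h.trans (mul_le_one₀ hx (norm_nonneg _) hu)
  · refine Metric.equicontinuous_of_continuity_modulus (fun t => √t) ?_ _ ?_
    · have := Real.continuous_sqrt.tendsto 0
      rwa [Real.sqrt_zero] at this
    · rintro x y ⟨_, u, hu, rfl⟩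
      have hu : ‖u‖ ≤ 1 := by simpa using hu
      have h := abs_integral_sub_le u x.2 y.2
      rw [← primitiveBCF_apply, ← primitiveBCF_apply] at h
      exact h.trans (mul_le_of_le_one_right (Real.sqrt_nonneg _) hu)

/-- Extension of continuous functions on `[0,1]` by constants. -/
noncomputable def extendBCF :
    BoundedContinuousFunction (Icc (0 : ℝ) 1) ℝ →L[ℝ] BoundedContinuousFunction ℝ ℝ :=
  LinearMap.mkContinuous
    { toFun := fun g => g.compContinuous ⟨projIcc 0 1 zero_le_one, continuous_projIcc⟩
      map_add' := fun _ _ => rfl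
      map_smul' := fun _ _ => rfl }
    1 (fun g => by
      rw [one_mul]
      exact (BoundedContinuousFunction.norm_le (norm_nonneg _)).2 fun x => g.norm_coe_le_norm _)

/-- The inclusion of the continuous functions on `[0,1]` in `L²([0,1])`. -/
noncomputable def inclBCF : BoundedContinuousFunction (Icc (0 : ℝ) 1) ℝ →L[ℝ] L2Unit :=
  BoundedContinuousFunction.toLp 2 unitMeasure ℝ ∘L extendBCF

theorem coeFn_inclBCF (g : BoundedContinuousFunction (Icc (0 : ℝ) 1) ℝ) :
    inclBCF g =ᵐ[unitMeasure] fun x => g (projIcc 0 1 zero_le_one x) :=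
  BoundedContinuousFunction.coeFn_toLp 2 unitMeasure ℝ _

/-- The Volterra operator on `L²([0,1])`. -/
noncomputable def volterra : L2Unit →L[ℝ] L2Unit := inclBCF ∘L primitiveBCF

theorem isCompactOperator_volterra : IsCompactOperator volterra :=
  isCompactOperator_primitiveBCF.clm_comp inclBCF

theorem volterra_apply (u : L2Unit) : volterra u = l2 (fun x => ∫ t in (0 : ℝ)..x, u t) := by
  refine eq_l2_of_ae ((coeFn_inclBCF _).trans ?_)
  refine ae_restrict_of_forall_mem measurableSet_Icc fun x hx => ?_
  simp only [projIcc_of_mem zero_le_one hx]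
  exact primitiveBCF_apply u ⟨x, hx⟩

theorem continuousOn_primitive (u : L2Unit) :
    ContinuousOn (fun x => ∫ t in (0 : ℝ)..x, u t) (Icc 0 1) := by
  have := ((intervalIntegrable_coe u).absolutelyContinuousOnInterval_intervalIntegral
    (c := 0) (by simp)).continuousOn
  rwa [uIcc_of_le zero_le_one] at this

theorem coeFn_volterra (u : L2Unit) :
    volterra u =ᵐ[unitMeasure] fun x => ∫ t in (0 : ℝ)..x, u t := by
  rw [volterra_apply]; exact coeFn_l2 (memLp_of_continuousOn (continuousOn_primitive u))

/-- The constant function `1`. -/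
noncomputable def oneL2 : L2Unit := l2 fun _ => 1

theorem coeFn_oneL2 : oneL2 =ᵐ[unitMeasure] fun _ => 1 := coeFn_l2 (memLp_const 1)

theorem inner_oneL2 (u : L2Unit) : ⟪oneL2, u⟫_ℝ = ∫ t in (0 : ℝ)..1, u t := by
  rw [inner_eq_integral]
  refine intervalIntegral_congr_unit ?_ (by simp) (by simp)
  filter_upwards [coeFn_oneL2] with x hx
  rw [hx, one_mul]

theorem volterra_oneL2 : volterra oneL2 = l2 fun x => x := by
  refine eq_l2_of_ae ((coeFn_volterra _).trans ?_)
  refine ae_restrict_of_forall_mem measurableSet_Icc fun x hx => ?_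
  simp only
  rw [intervalIntegral_congr_unit coeFn_oneL2 (by simp) hx]; simp

theorem ae_deriv_primitive (u : L2Unit) :
    ∀ᵐ x, x ∈ Icc (0 : ℝ) 1 → HasDerivAt (fun x => ∫ t in (0 : ℝ)..x, u t) (u x) x := by
  filter_upwards [(intervalIntegrable_coe u).ae_hasDerivAt_integral] with x hx hx'
  rw [← uIcc_of_le zero_le_one] at hx'
  exact hx hx' 0 (by simp)

/-- Integration by parts for absolutely continuous primitives. The adjoint of the Volterra operator
is thus its negative plus a rank-one boundary term. -/
theorem inner_volterra_add (u v : L2Unit) :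
    ⟪volterra u, v⟫_ℝ + ⟪u, volterra v⟫_ℝ = ⟪oneL2, u⟫_ℝ * ⟪oneL2, v⟫_ℝ := by
  have hU := (intervalIntegrable_coe u).absolutelyContinuousOnInterval_intervalIntegral
    (c := 0) (by simp)
  have hV := (intervalIntegrable_coe v).absolutelyContinuousOnInterval_intervalIntegral
    (c := 0) (by simp)
  have h := hU.integral_deriv_mul_eq_sub hV
  rw [intervalIntegral.integral_same, intervalIntegral.integral_same, zero_mul, sub_zero,
    ← inner_oneL2, ← inner_oneL2] at h
  rw [← h, inner_eq_integral, inner_eq_integral, ← intervalIntegral.integral_add]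
  · refine intervalIntegral_congr_unit ?_ (by simp) (by simp)
    have h1 := (ae_restrict_iff' measurableSet_Icc).2 (ae_deriv_primitive u)
    have h2 := (ae_restrict_iff' measurableSet_Icc).2 (ae_deriv_primitive v)
    filter_upwards [h1, h2, coeFn_volterra u, coeFn_volterra v] with x h1 h2 h3 h4
    rw [h1.deriv, h2.deriv, h3, h4]; ring
  · rw [intervalIntegrable_iff_integrableOn_Icc_of_le zero_le_one]
    exact (Lp.memLp (volterra u)).integrable_mul (Lp.memLp v)
  · rw [intervalIntegrable_iff_integrableOn_Icc_of_le zero_le_one]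
    exact (Lp.memLp u).integrable_mul (Lp.memLp (volterra v))

/-- A continuous primitive that vanishes almost everywhere vanishes identically, and Lebesgue
differentiation recovers `u`. -/
theorem volterra_injective {u : L2Unit} (h : volterra u = 0) : u = 0 := by
  have h0 : (fun x => ∫ t in (0 : ℝ)..x, u t) =ᵐ[unitMeasure] fun _ => 0 := by
    refine (coeFn_volterra u).symm.trans ?_
    rw [h]; exact Lp.coeFn_zero _ _ _
  have h1 := Measure.eqOn_Icc_of_ae_eq volume zero_ne_one h0 (continuousOn_primitive u)
    continuousOn_const
  refine Lp.ext (EventuallyEq.trans ?_ (Lp.coeFn_zero ℝ 2 unitMeasure).symm)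
  suffices h2 : ∀ᵐ x ∂volume.restrict (Ioo (0 : ℝ) 1), u x = 0 by
    rw [restrict_Ioo_eq_restrict_Icc] at h2; exact h2
  refine (ae_restrict_iff' measurableSet_Ioo).2 ?_
  filter_upwards [ae_deriv_primitive u] with x hx hxI
  have h2 := hx (Ioo_subset_Icc_self hxI)
  have h3 : (fun x => ∫ t in (0 : ℝ)..x, u t) =ᶠ[𝓝 x] fun _ => 0 := by
    filter_upwards [isOpen_Ioo.mem_nhds hxI] with y hy
    exact h1 (Ioo_subset_Icc_self hy)
  exact h2.unique ((hasDerivAt_const x (0 : ℝ)).congr_of_eventuallyEq h3)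

/-! ### The beam operator and completeness -/

/-- The space of affine functions. -/
noncomputable def affineL2 : Submodule ℝ L2Unit := Submodule.span ℝ {oneL2, volterra oneL2}

instance : FiniteDimensional ℝ affineL2 :=
  FiniteDimensional.span_of_finite ℝ (Set.toFinite _)

theorem inner_of_mem_orthogonal {u : L2Unit} (hu : u ∈ affineL2ᗮ) :
    ⟪oneL2, u⟫_ℝ = 0 ∧ ⟪volterra oneL2, u⟫_ℝ = 0 :=
  ⟨hu _ (Submodule.subset_span (by simp)), hu _ (Submodule.subset_span (by simp))⟩

/-- With `⟪oneL2, u⟫ = 0`, this says that the first and second primitives of `u` vanish at `1`: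
these are the free boundary conditions there. -/
theorem inner_one_volterra {u : L2Unit} (hu : u ∈ affineL2ᗮ) : ⟪oneL2, volterra u⟫_ℝ = 0 := by
  have h := inner_volterra_add oneL2 u
  rw [(inner_of_mem_orthogonal hu).1, (inner_of_mem_orthogonal hu).2] at h
  simpa using h

/-- The solution operator of the free beam problem, up to the affine functions. -/
noncomputable def beamOp : L2Unit →L[ℝ] L2Unit :=
  affineL2ᗮ.starProjection ∘L (volterra ∘L volterra ∘L volterra ∘L volterra)
    ∘L affineL2ᗮ.starProjection

theorem isCompactOperator_beamOp : IsCompactOperator beamOp :=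
  ((isCompactOperator_volterra.comp_clm (volterra ∘L volterra ∘L volterra)).comp_clm
    affineL2ᗮ.starProjection).clm_comp affineL2ᗮ.starProjection

/-- Two integrations by parts move two of the four Volterra factors across; both boundary terms
vanish because the projected `v` is orthogonal to the affine functions. Symmetry and the description
of the kernel both follow. -/
theorem inner_beamOp (u v : L2Unit) :
    ⟪beamOp u, v⟫_ℝ = ⟪volterra (volterra (affineL2ᗮ.starProjection u)),
      volterra (volterra (affineL2ᗮ.starProjection v))⟫_ℝ := by
  have h : ⟪beamOp u, v⟫_ℝ = ⟪volterra (volterra (volterra (volterra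
      (affineL2ᗮ.starProjection u)))), affineL2ᗮ.starProjection v⟫_ℝ :=
    Submodule.inner_starProjection_left_eq_right _ _ _
  rw [h]
  have hv : affineL2ᗮ.starProjection v ∈ affineL2ᗮ := Submodule.starProjection_apply_mem _ _
  generalize affineL2ᗮ.starProjection v = v' at *
  generalize affineL2ᗮ.starProjection u = u' at *
  have h1 := inner_volterra_add (volterra (volterra (volterra u'))) v'
  have h2 := inner_volterra_add (volterra (volterra u')) (volterra v')
  rw [(inner_of_mem_orthogonal hv).1] at h1
  rw [inner_one_volterra hv] at h2
  linarith

theorem isSymmetric_beamOp : beamOp.IsSymmetric := fun u v => by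
  have h1 := inner_beamOp u v
  have h2 := inner_beamOp v u
  rw [real_inner_comm] at h2
  exact h1.trans ((real_inner_comm _ _).trans h2.symm)

theorem mem_affineL2_of_beamOp_eq_zero {u : L2Unit} (h : beamOp u = 0) : u ∈ affineL2 := by
  have h1 := inner_beamOp u u
  rw [h, inner_zero_left] at h1
  have h2 := volterra_injective (volterra_injective (inner_self_eq_zero.1 h1.symm))
  rw [Submodule.starProjection_apply_eq_zero_iff] at h2
  rwa [Submodule.orthogonal_orthogonal] at h2

theorem hasDerivWithinAt_primitive {f : ℝ → ℝ} (hf : ContinuousOn f (Icc 0 1)) (x : ℝ)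
    (hx : x ∈ Icc (0 : ℝ) 1) :
    HasDerivWithinAt (fun x => ∫ t in (0 : ℝ)..x, f t) (f x) (Icc 0 1) x := by
  have : Fact (x ∈ Icc (0 : ℝ) 1) := ⟨hx⟩
  refine intervalIntegral.integral_hasDerivWithinAt_right
    ((intervalIntegrable_unit hf).mono_set ?_)
    (hf.stronglyMeasurableAtFilter_nhdsWithin measurableSet_Icc x) (hf x hx)
  rw [uIcc_of_le hx.1, uIcc_of_le zero_le_one]; exact Icc_subset_Icc_right hx.2

theorem volterra_l2 {f : ℝ → ℝ} (hf : MemLp f 2 unitMeasure) :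
    volterra (l2 f) = l2 fun x => ∫ t in (0 : ℝ)..x, f t := by
  rw [volterra_apply]
  exact l2_congr (memLp_of_continuousOn (continuousOn_primitive _)) fun x hx =>
    intervalIntegral_congr_unit (coeFn_l2 hf) (by simp) hx

theorem isFreeBeam_affine (a b : ℝ) :
    IsFreeBeam 0 (fun x => a + b * x) (fun _ => b) (fun _ => 0) (fun _ => 0) := by
  refine ⟨fun x _ => ?_, fun x _ => hasDerivWithinAt_const _ _ _,
    fun x _ => hasDerivWithinAt_const _ _ _, fun x _ => ?_, rfl, rfl, rfl, rfl⟩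
  · have := (((hasDerivAt_id x).const_mul b).const_add a).hasDerivWithinAt (s := Icc 0 1)
    simpa using this
  · rw [zero_mul]; exact hasDerivWithinAt_const _ _ _

theorem affine_l2 (a b : ℝ) :
    a • oneL2 + b • volterra oneL2 = l2 (fun x => a + b * x) := by
  have m1 : MemLp (fun _ : ℝ => (1 : ℝ)) 2 unitMeasure := memLp_const 1
  have m2 : MemLp (fun x : ℝ => x) 2 unitMeasure := memLp_of_continuousOn continuousOn_id
  rw [volterra_oneL2, oneL2, ← l2_smul a m1, ← l2_smul b m2,
    ← l2_add (m1.const_smul a) (m2.const_smul b)]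
  congr 1; funext x; simp

/-- For `κ ≠ 0`, `u` equals `κ⁻¹ (V⁴u - affine)`, so it has a representative with fourth derivative
`κ⁻¹ u`. Its second and third derivatives are multiples of `V²u` and `Vu`, which vanish at `0` by
construction and at `1` by orthogonality. For `κ = 0`, `u` is affine. -/
theorem exists_isFreeBeam_of_beamOp {κ : ℝ} {u : L2Unit} (h : beamOp u = κ • u) :
    ∃ r g g₁ g₂ g₃, IsFreeBeam r g g₁ g₂ g₃ ∧ u = l2 g := by
  rcases eq_or_ne κ 0 with rfl | hκ
  · rw [zero_smul] at h
    obtain ⟨a, b, hab⟩ := Submodule.mem_span_pair.1 (mem_affineL2_of_beamOp_eq_zero h)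
    exact ⟨0, _, _, _, _, isFreeBeam_affine a b, by rw [← hab, affine_l2]⟩
  have hu : u ∈ affineL2ᗮ := by
    have : u = κ⁻¹ • beamOp u := by rw [h, smul_smul, inv_mul_cancel₀ hκ, one_smul]
    rw [this]
    exact Submodule.smul_mem _ _ (Submodule.starProjection_apply_mem _ _)
  have hP : affineL2ᗮ.starProjection u = u := Submodule.starProjection_eq_self_iff.2 hu
  have hM : volterra (volterra (volterra (volterra u))) - κ • u ∈ affineL2 := by
    rw [← Submodule.orthogonal_orthogonal affineL2, ← Submodule.starProjection_apply_eq_zero_iff,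
      map_sub, map_smul, hP, ← h]
    simp only [beamOp, ContinuousLinearMap.comp_apply, hP, sub_self]
  obtain ⟨a, b, hab⟩ := Submodule.mem_span_pair.1 hM
  set F₁ : ℝ → ℝ := fun x => ∫ t in (0 : ℝ)..x, u t with hF₁
  set F₂ : ℝ → ℝ := fun x => ∫ t in (0 : ℝ)..x, F₁ t with hF₂
  set F₃ : ℝ → ℝ := fun x => ∫ t in (0 : ℝ)..x, F₂ t with hF₃
  set F₄ : ℝ → ℝ := fun x => ∫ t in (0 : ℝ)..x, F₃ t with hF₄
  have c1 : ContinuousOn F₁ (Icc 0 1) := continuousOn_primitive u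
  have d2 := hasDerivWithinAt_primitive c1
  have d3 := hasDerivWithinAt_primitive (continuousOn_of_deriv d2)
  have d4 := hasDerivWithinAt_primitive (continuousOn_of_deriv d3)
  have v1 : volterra u = l2 F₁ := volterra_apply u
  have v2 : volterra (volterra u) = l2 F₂ := by rw [v1, volterra_l2 (memLp_of_continuousOn c1)]
  have v4 : volterra (volterra (volterra (volterra u))) = l2 F₄ := by
    rw [v2, volterra_l2 (memLp_of_continuousOn (continuousOn_of_deriv d2)),
      volterra_l2 (memLp_of_continuousOn (continuousOn_of_deriv d3))]
  set g : ℝ → ℝ := fun x => κ⁻¹ * (F₄ x - (a + b * x)) with hg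
  have dg : ∀ x ∈ Icc (0 : ℝ) 1, HasDerivWithinAt g (κ⁻¹ * (F₃ x - b)) (Icc 0 1) x :=
    fun x hx => ((d4 x hx).sub ((isFreeBeam_affine a b).deriv₁ x hx)).const_mul _
  have ug : u = l2 g := by
    have m4 := memLp_of_continuousOn (continuousOn_of_deriv d4)
    have ma := memLp_of_continuousOn (isFreeBeam_affine a b).cont
    have : g = κ⁻¹ • (F₄ - fun x => a + b * x) := by funext x; simp [hg]
    rw [this, l2_smul _ (m4.sub ma), l2_sub m4 ma, ← affine_l2, hab, ← v4, sub_sub_cancel,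
      smul_smul, inv_mul_cancel₀ hκ, one_smul]
  have cg := continuousOn_of_deriv dg
  -- Bootstrap: `F₁` is also the primitive of the continuous representative `g`, hence
  -- differentiable at every point and not only almost everywhere.
  have e1 : EqOn F₁ (fun x => ∫ t in (0 : ℝ)..x, g t) (Icc 0 1) := fun x hx => by
    have : u =ᵐ[unitMeasure] g := by
      have := coeFn_l2 (memLp_of_continuousOn cg)
      rwa [← ug] at this
    exact intervalIntegral_congr_unit this (by simp) hx
  have d1 : ∀ x ∈ Icc (0 : ℝ) 1, HasDerivWithinAt F₁ (g x) (Icc 0 1) x := fun x hx =>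
    (hasDerivWithinAt_primitive cg x hx).congr e1 (e1 hx)
  refine ⟨κ⁻¹, g, fun x => κ⁻¹ * (F₃ x - b), fun x => κ⁻¹ * F₂ x, fun x => κ⁻¹ * F₁ x,
    ⟨dg, fun x hx => ((d3 x hx).sub_const b).const_mul _, fun x hx => (d2 x hx).const_mul _,
      fun x hx => (d1 x hx).const_mul _, ?_, ?_, ?_, ?_⟩, ug⟩
  · simp [hF₂]
  · have h2 : F₂ 1 = 0 := by
      have h := inner_one_volterra hu
      rw [inner_oneL2] at h
      rw [← h]
      exact intervalIntegral_congr_unit (coeFn_volterra u).symm (by simp) (by simp)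
    simp [h2]
  · simp [hF₁]
  · have h1 : F₁ 1 = 0 := by rw [← (inner_of_mem_orthogonal hu).1, inner_oneL2]
    simp [h1]

/-- The solutions of the free beam problem are complete in `L²([0,1])`. -/
theorem eq_zero_of_forall_inner_isFreeBeam {u : L2Unit}
    (h : ∀ r g g₁ g₂ g₃, IsFreeBeam r g g₁ g₂ g₃ → ⟪l2 g, u⟫_ℝ = 0) : u = 0 := by
  -- By the spectral theorem, only zero is orthogonal to all eigenvectors of `beamOp`, and each of
  -- these is a beam solution.
  have key := ContinuousLinearMap.orthogonalComplement_iSup_eigenspaces_eq_bot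
    isCompactOperator_beamOp isSymmetric_beamOp
  rw [← Submodule.mem_bot ℝ, ← key, ← Submodule.iInf_orthogonal, Submodule.mem_iInf]
  intro κ v hv
  obtain ⟨r, g, g₁, g₂, g₃, hg, rfl⟩ :=
    exists_isFreeBeam_of_beamOp (Module.End.mem_eigenspace_iff.1 hv)
  exact h r g g₁ g₂ g₃ hg

/-! ### Bessel identities for unnormalized orthogonal families -/

section Orthogonal

variable {ι H : Type*} [NormedAddCommGroup H] [InnerProductSpace ℝ H] [DecidableEq ι]
  {v : ι → H} {w : ι → ℝ}

theorem norm_sum_sq_of_orthogonal (hv : ∀ i j, ⟪v i, v j⟫_ℝ = if i = j then w i else 0)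
    (a : ι → ℝ) (S : Finset ι) : ‖∑ i ∈ S, a i • v i‖ ^ 2 = ∑ i ∈ S, w i * a i ^ 2 := by
  rw [← real_inner_self_eq_norm_sq, sum_inner]
  refine Finset.sum_congr rfl fun i hi => ?_
  rw [inner_sum, Finset.sum_eq_single_of_mem i hi]
  · rw [inner_smul_left, inner_smul_right, hv, if_pos rfl]; simp; ring
  · intro j _ hj
    rw [inner_smul_left, inner_smul_right, hv, if_neg hj.symm]; simp

/-- Weights may be zero, which lets the identity apply to the second derivatives `φ_i''`: their
squared norms `ρ_i` vanish on affine modes. -/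
theorem norm_sub_sum_sq_of_orthogonal (hv : ∀ i j, ⟪v i, v j⟫_ℝ = if i = j then w i else 0)
    {a : ι → ℝ} {f : H} (hf : ∀ i, ⟪f, v i⟫_ℝ = w i * a i) (S : Finset ι) :
    ‖f - ∑ i ∈ S, a i • v i‖ ^ 2 = ‖f‖ ^ 2 - ∑ i ∈ S, w i * a i ^ 2 := by
  rw [norm_sub_sq_real, norm_sum_sq_of_orthogonal hv, inner_sum]
  have : ∑ i ∈ S, ⟪f, a i • v i⟫_ℝ = ∑ i ∈ S, w i * a i ^ 2 :=
    Finset.sum_congr rfl fun i _ => by rw [inner_smul_right, hf]; ring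
  rw [this]; ring

end Orthogonal

/-! ### Two-sided bounds for local spectral sums -/

/-- A family of solutions of the free beam problem, orthonormal in `L²([0,1])`. -/
structure IsBeamSystem {ι : Type*} (φ φ₁ φ₂ φ₃ : ι → ℝ → ℝ) (ρ : ι → ℝ) : Prop where
  beam : ∀ i, IsFreeBeam (ρ i) (φ i) (φ₁ i) (φ₂ i) (φ₃ i)
  norm_one : ∀ i, ∫ x in (0 : ℝ)..1, φ i x * φ i x = 1
  orthogonal : ∀ i j, i ≠ j → ∫ x in (0 : ℝ)..1, φ i x * φ j x = 0

theorem norm_l2_sq {f : ℝ → ℝ} (hf : ContinuousOn f (Icc 0 1)) :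
    ‖l2 f‖ ^ 2 = ∫ x in (0 : ℝ)..1, f x ^ 2 := by
  rw [← real_inner_self_eq_norm_sq,
    inner_l2 (memLp_of_continuousOn hf) (memLp_of_continuousOn hf)]
  simp_rw [sq]

theorem integral_bump_le {z h : ℝ} (hh : 0 < h) :
    ∫ x in (0 : ℝ)..1, (1 + ((x - z) / h) ^ 2)⁻¹ ≤ Real.pi * h := by
  have hd : ∀ x : ℝ, HasDerivAt (fun x => h * Real.arctan ((x - z) / h))
      ((1 + ((x - z) / h) ^ 2)⁻¹) x := fun x => by
    have := (((((hasDerivAt_id x).sub_const z).div_const h)).arctan).const_mul h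
    convert! this using 1
    have : 1 + ((x - z) / h) ^ 2 ≠ 0 := by positivity
    simp only [id]
    field_simp
  have hc : Continuous fun x : ℝ => (1 + ((x - z) / h) ^ 2)⁻¹ := by
    refine Continuous.inv₀ (by fun_prop) fun x => ?_
    positivity
  rw [intervalIntegral.integral_eq_sub_of_hasDerivAt (fun x _ => hd x) (hc.intervalIntegrable _ _)]
  have h1 := Real.arctan_lt_pi_div_two ((1 - z) / h)
  have h2 := Real.neg_pi_div_two_lt_arctan ((0 - z) / h)
  nlinarith

/-- A function with value `1` at `z` that lives on the scale `h`. -/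
theorem exists_bump (z : ℝ) {h : ℝ} (hh : 0 < h) :
    ∃ f f₁ f₂, HasTwoDerivs f f₁ f₂ ∧ f z = 1 ∧ (∫ x in (0 : ℝ)..1, f x ^ 2) ≤ Real.pi * h ∧
      h ^ 4 * (∫ x in (0 : ℝ)..1, f₂ x ^ 2) ≤ 36 * Real.pi * h := by
  set f : ℝ → ℝ := fun x => (1 + ((x - z) / h) ^ 2)⁻¹ with hf
  set f₁ : ℝ → ℝ := fun x => -(2 * ((x - z) / h) / h) / (1 + ((x - z) / h) ^ 2) ^ 2 with hf₁
  set f₂ : ℝ → ℝ := fun x =>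
    (6 * ((x - z) / h) ^ 2 - 2) / (1 + ((x - z) / h) ^ 2) ^ 3 / h ^ 2 with hf₂
  have hp : ∀ x : ℝ, 1 + ((x - z) / h) ^ 2 ≠ 0 := fun x => by positivity
  have dt : ∀ x : ℝ, HasDerivAt (fun x => (x - z) / h) (1 / h) x := fun x =>
    ((hasDerivAt_id x).sub_const z).div_const h
  have dq : ∀ x : ℝ, HasDerivAt (fun x => 1 + ((x - z) / h) ^ 2) (2 * ((x - z) / h) / h) x := fun x => by
    have := ((dt x).pow 2).const_add 1
    convert! this using 1
    simp; ring
  have d1 : ∀ x : ℝ, HasDerivAt f (f₁ x) x := fun x => (dq x).inv (hp x)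
  have d2 : ∀ x : ℝ, HasDerivAt f₁ (f₂ x) x := fun x => by
    have := ((((dt x).const_mul 2).div_const h).neg).div ((dq x).pow 2) (pow_ne_zero 2 (hp x))
    convert! this using 1
    simp only [hf₂, Pi.pow_apply, Pi.neg_apply]
    have ht := hp x
    clear this d1 dq dt hp hf hf₁ hf₂ f f₁ f₂
    generalize (x - z) / h = t at *
    field_simp
    simp
    ring
  have c : Continuous f := continuous_iff_continuousAt.2 fun x => (d1 x).continuousAt
  have c2 : Continuous f₂ := by
    refine Continuous.div_const (Continuous.div (by fun_prop) (by fun_prop) fun x => ?_) _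
    exact pow_ne_zero 3 (hp x)
  refine ⟨f, f₁, f₂, ⟨fun x _ => (d1 x).hasDerivWithinAt, fun x _ => (d2 x).hasDerivWithinAt,
    c2.continuousOn⟩, by simp [hf], ?_, ?_⟩
  · refine le_trans (intervalIntegral.integral_mono_on zero_le_one
      ((c.pow 2).intervalIntegrable _ _) (c.intervalIntegrable _ _) fun x _ => ?_)
      -- The Lorentzian `f` takes values in `[0, 1]`, so `f² ≤ f`, and its integral is controlled by
      -- the arctangent.
      (integral_bump_le hh)
    have h0 : 0 ≤ f x := by simp only [hf]; positivity
    have h1 : f x ≤ 1 := inv_le_one_of_one_le₀ (by nlinarith [sq_nonneg ((x - z) / h)])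
    nlinarith
  · rw [← intervalIntegral.integral_const_mul, mul_assoc]
    refine le_trans (intervalIntegral.integral_mono_on zero_le_one
      ((continuous_const.mul (c2.pow 2)).intervalIntegrable _ _)
      ((continuous_const.mul c).intervalIntegrable _ _) (g := fun x => 36 * f x) fun x _ => ?_) ?_
    -- Pointwise, `h⁴ f₂² ≤ 36 f`, by `|6t² - 2| ≤ 6(1 + t²)` with `t = (x - z)/h`.
    · simp only [hf, hf₂]
      generalize (x - z) / h = t
      have hq : 0 < 1 + t ^ 2 := by positivity
      have e : h ^ 4 * ((6 * t ^ 2 - 2) / (1 + t ^ 2) ^ 3 / h ^ 2) ^ 2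
          = (6 * t ^ 2 - 2) ^ 2 / (1 + t ^ 2) ^ 6 := by field_simp
      rw [e, ← div_eq_mul_inv, div_le_div_iff₀ (by positivity) hq]
      have a1 : (6 * t ^ 2 - 2) ^ 2 ≤ 36 * (1 + t ^ 2) ^ 2 := by nlinarith [sq_nonneg t]
      have a2 : (1 + t ^ 2) ^ 3 ≤ (1 + t ^ 2) ^ 6 :=
        pow_le_pow_right₀ (by nlinarith [sq_nonneg t]) (by norm_num)
      calc (6 * t ^ 2 - 2) ^ 2 * (1 + t ^ 2) ≤ 36 * (1 + t ^ 2) ^ 2 * (1 + t ^ 2) :=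
            mul_le_mul_of_nonneg_right a1 hq.le
        _ = 36 * (1 + t ^ 2) ^ 3 := by ring
        _ ≤ 36 * (1 + t ^ 2) ^ 6 := by linarith
    · rw [intervalIntegral.integral_const_mul]
      exact mul_le_mul_of_nonneg_left (integral_bump_le hh) (by norm_num)

namespace IsBeamSystem

variable {ι : Type*} {φ φ₁ φ₂ φ₃ : ι → ℝ → ℝ} {ρ : ι → ℝ}

theorem nonneg (hs : IsBeamSystem φ φ₁ φ₂ φ₃ ρ) (i : ι) : 0 ≤ ρ i :=
  (hs.beam i).nonneg (hs.norm_one i)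

theorem memLp (hs : IsBeamSystem φ φ₁ φ₂ φ₃ ρ) (i : ι) : MemLp (φ i) 2 unitMeasure :=
  memLp_of_continuousOn (hs.beam i).cont

theorem memLp₂ (hs : IsBeamSystem φ φ₁ φ₂ φ₃ ρ) (i : ι) : MemLp (φ₂ i) 2 unitMeasure :=
  memLp_of_continuousOn (hs.beam i).hasTwoDerivs.cont₂

theorem inner_l2 [DecidableEq ι] (hs : IsBeamSystem φ φ₁ φ₂ φ₃ ρ) (i j : ι) :
    ⟪l2 (φ i), l2 (φ j)⟫_ℝ = if i = j then 1 else 0 := by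
  rw [SplineBvM.inner_l2 (hs.memLp i) (hs.memLp j)]
  split_ifs with h
  · rw [← h]; exact hs.norm_one i
  · exact hs.orthogonal i j h

theorem inner_l2₂ [DecidableEq ι] (hs : IsBeamSystem φ φ₁ φ₂ φ₃ ρ) (i j : ι) :
    ⟪l2 (φ₂ i), l2 (φ₂ j)⟫_ℝ = if i = j then ρ i else 0 := by
  rw [SplineBvM.inner_l2 (hs.memLp₂ i) (hs.memLp₂ j),
    IsFreeBeam.integral_second_deriv_mul (hs.beam i).hasTwoDerivs (hs.beam j)]
  split_ifs with h
  · rw [← h, hs.norm_one i, mul_one]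
  · rw [hs.orthogonal i j h, mul_zero]

theorem orthonormal (hs : IsBeamSystem φ φ₁ φ₂ φ₃ ρ) : Orthonormal ℝ fun i => l2 (φ i) := by
  classical
  exact orthonormal_iff_ite.2 hs.inner_l2

/-- Apply the Sobolev inequality to the truncated kernel `∑ a_i φ_i` with `a_i = φ_i(z) / (1 + h⁴
ρ_i)`. Both its value at `z` and its squared norm equal the sum `K` in question, so `K² ≤ (32/h) K`.
-/
theorem sum_sq_div_le (hs : IsBeamSystem φ φ₁ φ₂ φ₃ ρ) {z h : ℝ} (hz : z ∈ Icc (0 : ℝ) 1)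
    (h0 : 0 < h) (h1 : h ≤ 1 / 2) (S : Finset ι) :
    ∑ i ∈ S, φ i z ^ 2 / (1 + h ^ 4 * ρ i) ≤ 32 / h := by
  classical
  set a : ι → ℝ := fun i => φ i z / (1 + h ^ 4 * ρ i) with ha
  have hd : ∀ i, 0 < 1 + h ^ 4 * ρ i := fun i => by have := hs.nonneg i; positivity
  have hT := HasTwoDerivs.sum (fun i => (hs.beam i).hasTwoDerivs) a S
  have key := hT.sq_le hz h0 h1
  rw [← norm_l2_sq hT.cont, ← norm_l2_sq hT.cont₂, l2_sum hs.memLp, l2_sum hs.memLp₂,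
    norm_sum_sq_of_orthogonal hs.inner_l2, norm_sum_sq_of_orthogonal hs.inner_l2₂] at key
  have e1 : (∑ i ∈ S, a i • φ i) z = ∑ i ∈ S, φ i z ^ 2 / (1 + h ^ 4 * ρ i) := by
    rw [Finset.sum_apply]
    refine Finset.sum_congr rfl fun i _ => ?_
    simp [ha]; ring
  have e2 : ∑ i ∈ S, 1 * a i ^ 2 + h ^ 4 * ∑ i ∈ S, ρ i * a i ^ 2
      = ∑ i ∈ S, φ i z ^ 2 / (1 + h ^ 4 * ρ i) := by
    rw [Finset.mul_sum, ← Finset.sum_add_distrib]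
    refine Finset.sum_congr rfl fun i _ => ?_
    have := (hd i).ne'
    simp only [ha]
    field_simp
  rw [e1, e2] at key
  set K := ∑ i ∈ S, φ i z ^ 2 / (1 + h ^ 4 * ρ i)
  by_contra hcon
  push Not at hcon
  have hK : 0 < K := lt_trans (by positivity) hcon
  nlinarith

/-- Integrate the pointwise kernel bound with `h = 1/2` over the interval; each normalized function
contributes `1` to the count. -/
theorem card_le (hs : IsBeamSystem φ φ₁ φ₂ φ₃ ρ) {R : ℝ} (hR : 0 ≤ R) (S : Finset ι)
    (hS : ∀ i ∈ S, ρ i ≤ R) : (S.card : ℝ) ≤ 64 * (1 + R) := by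
  have hc : ∀ i, ContinuousOn (fun x => φ i x * φ i x) (Icc 0 1) := fun i =>
    (hs.beam i).cont.mul (hs.beam i).cont
  have e : (S.card : ℝ) = ∫ x in (0 : ℝ)..1, ∑ i ∈ S, φ i x * φ i x := by
    rw [intervalIntegral.integral_finsetSum fun i _ => intervalIntegrable_unit (hc i)]
    simp [hs.norm_one]
  have e2 : (64 * (1 + R)) = ∫ _ in (0 : ℝ)..1, 64 * (1 + R) := by simp
  rw [e, e2]
  refine intervalIntegral.integral_mono_on zero_le_one
    (intervalIntegrable_unit (continuousOn_finsetSum S fun i _ => hc i))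
    intervalIntegrable_const fun x hx => ?_
  have key := hs.sum_sq_div_le hx (h := 1 / 2) (by norm_num) le_rfl S
  have : ∑ i ∈ S, φ i x * φ i x ≤ (1 + R) * ∑ i ∈ S, φ i x ^ 2 / (1 + (1 / 2) ^ 4 * ρ i) := by
    rw [Finset.mul_sum]
    refine Finset.sum_le_sum fun i hi => ?_
    have h1 := hs.nonneg i
    have h2 := hS i hi
    rw [← mul_div_assoc, le_div_iff₀ (by positivity)]
    nlinarith [sq_nonneg (φ i x)]
  calc _ ≤ _ := this
    _ ≤ (1 + R) * (32 / (1 / 2)) := mul_le_mul_of_nonneg_left key (by positivity)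
    _ = _ := by ring

theorem finite_le (hs : IsBeamSystem φ φ₁ φ₂ φ₃ ρ) (R : ℝ) : {i | ρ i ≤ R}.Finite := by
  rcases lt_or_ge R 0 with hR | hR
  · convert! Set.finite_empty
    exact Set.eq_empty_of_forall_notMem fun i hi => absurd (hs.nonneg i) (not_le.2 (lt_of_le_of_lt hi hR))
  by_contra hinf
  obtain ⟨n, hn⟩ := exists_nat_gt (64 * (1 + R))
  obtain ⟨S, hS, hcard⟩ := Set.Infinite.exists_subset_card_eq hinf n
  have := hs.card_le hR S fun i hi => hS hi
  rw [hcard] at this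
  linarith

/-- The system is complete in `L²([0,1])`. -/
def Complete (φ : ι → ℝ → ℝ) : Prop := ∀ u : L2Unit, (∀ i, ⟪l2 (φ i), u⟫_ℝ = 0) → u = 0

theorem hasSum_repr (hs : IsBeamSystem φ φ₁ φ₂ φ₃ ρ) (hc : Complete φ) (u : L2Unit) :
    HasSum (fun i => ⟪l2 (φ i), u⟫_ℝ • l2 (φ i)) u := by
  have hbot : (Submodule.span ℝ (Set.range fun i => l2 (φ i)))ᗮ = ⊥ := by
    refine (Submodule.eq_bot_iff _).2 fun u hu => hc u fun i => ?_
    exact hu _ (Submodule.subset_span ⟨i, rfl⟩)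
  have := (HilbertBasis.mkOfOrthogonalEqBot hs.orthonormal hbot).hasSum_repr u
  simpa [HilbertBasis.repr_apply_apply] using this

/-- Duality: a partial expansion of the bump has value at least `1/2` at `z` and energy at most
`37πh`, so Cauchy–Schwarz forces `K ≥ 1/(4 · 37πh)`. -/
theorem exists_sum_sq_div_ge (hs : IsBeamSystem φ φ₁ φ₂ φ₃ ρ) (hc : Complete φ) {z h : ℝ}
    (hz : z ∈ Icc (0 : ℝ) 1) (hh : 0 < h) :
    ∃ S : Finset ι, 1 / (148 * Real.pi * h) ≤ ∑ i ∈ S, φ i z ^ 2 / (1 + h ^ 4 * ρ i) := by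
  classical
  obtain ⟨f, f₁, f₂, hf, hfz, hI, hI₂⟩ := exists_bump z hh
  have mf := memLp_of_continuousOn hf.cont
  have mf₂ := memLp_of_continuousOn hf.cont₂
  set a : ι → ℝ := fun i => ⟪l2 (φ i), l2 f⟫_ℝ with ha
  have hfa : ∀ i, ⟪l2 f, l2 (φ i)⟫_ℝ = 1 * a i := fun i => by rw [one_mul, real_inner_comm]
  have hfa₂ : ∀ i, ⟪l2 f₂, l2 (φ₂ i)⟫_ℝ = ρ i * a i := fun i => by
    rw [SplineBvM.inner_l2 mf₂ (hs.memLp₂ i), IsFreeBeam.integral_second_deriv_mul hf (hs.beam i),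
      ← one_mul (a i), ← hfa i, SplineBvM.inner_l2 mf (hs.memLp i)]
  have hN := norm_sub_sum_sq_of_orthogonal hs.inner_l2 hfa
  have hN₂ := norm_sub_sum_sq_of_orthogonal hs.inner_l2₂ hfa₂
  set B := ‖l2 f₂‖ ^ 2 with hB
  have hB0 : 0 ≤ B := sq_nonneg _
  -- An auxiliary bandwidth turns L² convergence into convergence at `z`. The second derivatives of
  -- the remainder need only stay bounded by `B`, since `η` makes their contribution at most `1/8`;
  -- the L² error below `η/256` contributes at most another `1/8`.
  obtain ⟨η, hη0, hη1, hηB⟩ : ∃ η : ℝ, 0 < η ∧ η ≤ 1 / 2 ∧ 32 * η ^ 3 * B ≤ 1 / 8 := by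
    refine ⟨1 / (256 * (B + 1)), by positivity, ?_, ?_⟩
    · rw [div_le_div_iff₀ (by positivity) (by norm_num)]; linarith
    · have h1 : 1 / (256 * (B + 1)) ≤ 1 := by
        rw [div_le_one (by positivity)]; linarith
      have h0 : 0 < 1 / (256 * (B + 1)) := by positivity
      have h3 : (1 / (256 * (B + 1))) ^ 3 ≤ 1 / (256 * (B + 1)) :=
        pow_le_of_le_one h0.le h1 (by norm_num)
      have h4 : 1 / (256 * (B + 1)) * B ≤ 1 / 256 := by
        rw [div_mul_eq_mul_div, div_le_div_iff₀ (by positivity) (by norm_num)]; linarith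
      nlinarith [mul_le_mul_of_nonneg_right h3 hB0]
  obtain ⟨S, hS⟩ : ∃ S : Finset ι, ‖l2 f - ∑ i ∈ S, a i • l2 (φ i)‖ ^ 2 < η / 256 := by
    have h1 : Tendsto (fun S : Finset ι => ‖l2 f - ∑ i ∈ S, a i • l2 (φ i)‖ ^ 2) atTop
        (𝓝 (‖l2 f - l2 f‖ ^ 2)) := ((hs.hasSum_repr hc (l2 f)).const_sub (l2 f)).norm.pow 2
    rw [sub_self, norm_zero, zero_pow two_ne_zero] at h1
    exact (h1.eventually (gt_mem_nhds (show 0 < η / 256 by positivity))).exists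
  refine ⟨S, ?_⟩
  have hT := HasTwoDerivs.sum (fun i => (hs.beam i).hasTwoDerivs) a S
  have hg := hf.sub hT
  have key := hg.sq_le hz hη0 hη1
  rw [← norm_l2_sq hg.cont, ← norm_l2_sq hg.cont₂, l2_sub mf (memLp_of_continuousOn hT.cont),
    l2_sub mf₂ (memLp_of_continuousOn hT.cont₂), l2_sum hs.memLp, l2_sum hs.memLp₂, hN₂] at key
  have hsmall : (f - ∑ i ∈ S, a i • φ i) z ^ 2 ≤ 1 / 4 := by
    refine key.trans ?_
    have : 32 / η * (‖l2 f - ∑ i ∈ S, a i • l2 (φ i)‖ ^ 2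
        + η ^ 4 * (‖l2 f₂‖ ^ 2 - ∑ i ∈ S, ρ i * a i ^ 2)) ≤ 32 / η * (η / 256 + η ^ 4 * B) := by
      have h5 : ‖l2 f₂‖ ^ 2 - ∑ i ∈ S, ρ i * a i ^ 2 ≤ B := by
        have : 0 ≤ ∑ i ∈ S, ρ i * a i ^ 2 :=
          Finset.sum_nonneg fun i _ => mul_nonneg (hs.nonneg i) (sq_nonneg _)
        linarith
      gcongr
    refine this.trans ?_
    have e : 32 / η * (η / 256 + η ^ 4 * B) = 1 / 8 + 32 * η ^ 3 * B := by field_simp; ring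
    rw [e]; linarith
  have hval : (f - ∑ i ∈ S, a i • φ i) z = 1 - ∑ i ∈ S, a i * φ i z := by
    simp [hfz]
  rw [hval] at hsmall
  have hhalf : 1 / 2 ≤ ∑ i ∈ S, a i * φ i z := by nlinarith
  set d : ι → ℝ := fun i => 1 + h ^ 4 * ρ i with hdd
  have hd : ∀ i, 0 < d i := fun i => by have := hs.nonneg i; simp only [hdd]; positivity
  have hCS : (∑ i ∈ S, a i * φ i z) ^ 2 ≤ (∑ i ∈ S, d i * a i ^ 2) * ∑ i ∈ S, φ i z ^ 2 / d i := by
    refine Finset.sum_sq_le_sum_mul_sum_of_sq_le_mul S (fun i _ => ?_) (fun i _ => ?_) fun i _ => ?_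
    · have := hd i; positivity
    · have := hd i; positivity
    · have := (hd i).ne'; exact le_of_eq (by field_simp)
  -- Bessel's inequality for the bump and for its second derivative; `37 = 1 + 36`.
  have hW : ∑ i ∈ S, d i * a i ^ 2 ≤ 37 * Real.pi * h := by
    have h6 : 0 ≤ ‖l2 f‖ ^ 2 - ∑ i ∈ S, 1 * a i ^ 2 := by rw [← hN]; positivity
    have h7 : 0 ≤ ‖l2 f₂‖ ^ 2 - ∑ i ∈ S, ρ i * a i ^ 2 := by rw [← hN₂]; positivity
    rw [norm_l2_sq hf.cont] at h6
    rw [norm_l2_sq hf.cont₂] at h7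
    have e : ∑ i ∈ S, d i * a i ^ 2 = ∑ i ∈ S, 1 * a i ^ 2 + h ^ 4 * ∑ i ∈ S, ρ i * a i ^ 2 := by
      rw [Finset.mul_sum, ← Finset.sum_add_distrib]
      exact Finset.sum_congr rfl fun i _ => by simp only [hdd]; ring
    rw [e]
    have h8 := mul_le_mul_of_nonneg_left (sub_nonneg.1 h7) (by positivity : 0 ≤ h ^ 4)
    linarith
  set K := ∑ i ∈ S, φ i z ^ 2 / d i with hK
  have hK0 : 0 ≤ K := Finset.sum_nonneg fun i _ => div_nonneg (sq_nonneg _) (hd i).le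
  have hpi := Real.pi_pos
  rw [div_le_iff₀ (by positivity)]
  have h9 : (1 / 2 : ℝ) ^ 2 ≤ (∑ i ∈ S, a i * φ i z) ^ 2 := by gcongr
  have h10 := mul_le_mul_of_nonneg_right hW hK0
  nlinarith

/-- Lower bound for the local spectral counting function. -/
theorem exists_sum_sq_ge (hs : IsBeamSystem φ φ₁ φ₂ φ₃ ρ) (hc : Complete φ) {z h : ℝ}
    (hz : z ∈ Icc (0 : ℝ) 1) (hh : 0 < h) (h1 : h ≤ 1) :
    ∃ S : Finset ι, (∀ i ∈ S, ρ i ≤ (40 / h) ^ 4) ∧ 1 / (1000 * h) ≤ ∑ i ∈ S, φ i z ^ 2 := by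
  classical
  obtain ⟨S, hS⟩ := hs.exists_sum_sq_div_ge hc hz hh
  refine ⟨{i ∈ S | ρ i ≤ (40 / h) ^ 4}, fun i hi => (Finset.mem_filter.1 hi).2, ?_⟩
  rw [← Finset.sum_filter_add_sum_filter_not S (fun i => ρ i ≤ (40 / h) ^ 4)] at hS
  have t1 : ∑ i ∈ S with ρ i ≤ (40 / h) ^ 4, φ i z ^ 2 / (1 + h ^ 4 * ρ i)
      ≤ ∑ i ∈ S with ρ i ≤ (40 / h) ^ 4, φ i z ^ 2 := by
    refine Finset.sum_le_sum fun i _ => div_le_self (sq_nonneg _) ?_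
    have := mul_nonneg (by positivity : 0 ≤ h ^ 4) (hs.nonneg i)
    linarith
  have t2 : ∑ i ∈ S with ¬ ρ i ≤ (40 / h) ^ 4, φ i z ^ 2 / (1 + h ^ 4 * ρ i)
      ≤ 1 / (1000 * h) := by
    -- Beyond the cutoff `(h/40)⁴ ρ_i ≥ 1`, so each term is at most `2/40⁴` times its analogue at
    -- bandwidth `h/40`. The upper bound there gives `2/40⁴ · 32 · 40/h = 1/(1000h)`.
    have u := hs.sum_sq_div_le hz (h := h / 40) (by positivity) (by linarith)
      {i ∈ S | ¬ ρ i ≤ (40 / h) ^ 4}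
    have : ∑ i ∈ S with ¬ ρ i ≤ (40 / h) ^ 4, φ i z ^ 2 / (1 + h ^ 4 * ρ i)
        ≤ 2 / 40 ^ 4 * ∑ i ∈ S with ¬ ρ i ≤ (40 / h) ^ 4, φ i z ^ 2 / (1 + (h / 40) ^ 4 * ρ i) := by
      rw [Finset.mul_sum]
      refine Finset.sum_le_sum fun i hi => ?_
      have hi := not_le.1 (Finset.mem_filter.1 hi).2
      have h0 := hs.nonneg i
      have hbig : 1 ≤ (h / 40) ^ 4 * ρ i := by
        have := mul_le_mul_of_nonneg_left hi.le (by positivity : 0 ≤ (h / 40) ^ 4)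
        have e : (h / 40) ^ 4 * (40 / h) ^ 4 = 1 := by field_simp
        linarith
      rw [← mul_div_assoc, div_le_div_iff₀ (by positivity) (by positivity)]
      have e2 : h ^ 4 * ρ i = 40 ^ 4 * ((h / 40) ^ 4 * ρ i) := by ring
      rw [e2]
      generalize (h / 40) ^ 4 * ρ i = t at *
      nlinarith [sq_nonneg (φ i z)]
    refine this.trans ((mul_le_mul_of_nonneg_left u (by norm_num)).trans ?_)
    have e : 2 / 40 ^ 4 * (32 / (h / 40)) = 1 / (1000 * h) := by field_simp; norm_num
    rw [e]
  have hpi := Real.pi_lt_d2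
  have hpi0 := Real.pi_pos
  -- As `148π < 500`, the full sum is at least twice the tail bound.
  have t3 : 2 / (1000 * h) ≤ 1 / (148 * Real.pi * h) := by
    rw [div_le_div_iff₀ (by positivity) (by positivity)]
    nlinarith
  have t4 : 2 / (1000 * h) = 1 / (1000 * h) + 1 / (1000 * h) := by ring
  linarith

/-- A finite family would have a bounded sum of squares at `1/2`, whereas the lower bound grows like
`1/h`. -/
theorem infinite (hs : IsBeamSystem φ φ₁ φ₂ φ₃ ρ) (hc : Complete φ) : Infinite ι := by
  by_contra hfin
  rw [not_infinite_iff_finite] at hfin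
  have := Fintype.ofFinite ι
  set T := ∑ i, φ i (1 / 2) ^ 2 with hT
  have hT0 : 0 ≤ T := Finset.sum_nonneg fun i _ => sq_nonneg _
  have hpos : 0 < 1 / (1000 * (T + 1)) := by positivity
  obtain ⟨S, -, hS⟩ := hs.exists_sum_sq_ge hc (z := 1 / 2) (h := 1 / (1000 * (T + 1)))
    (by norm_num) hpos (by rw [div_le_one (by positivity)]; linarith)
  have h1 : ∑ i ∈ S, φ i (1 / 2) ^ 2 ≤ T :=
    Finset.sum_le_sum_of_subset_of_nonneg (Finset.subset_univ _) fun i _ _ => sq_nonneg _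
  have e : 1 / (1000 * (1 / (1000 * (T + 1)))) = T + 1 := by field_simp
  rw [e] at hS
  linarith

end IsBeamSystem

/-! ### Existence of an ordered eigen-system -/

namespace IsFreeBeam
variable {r : ℝ} {f f₁ f₂ f₃ g g₁ g₂ g₃ : ℝ → ℝ}

theorem add (hf : IsFreeBeam r f f₁ f₂ f₃) (hg : IsFreeBeam r g g₁ g₂ g₃) :
    IsFreeBeam r (f + g) (f₁ + g₁) (f₂ + g₂) (f₃ + g₃) := by
  refine ⟨fun x hx => (hf.deriv₁ x hx).add (hg.deriv₁ x hx),
    fun x hx => (hf.deriv₂ x hx).add (hg.deriv₂ x hx),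
    fun x hx => (hf.deriv₃ x hx).add (hg.deriv₃ x hx), fun x hx => ?_, ?_, ?_, ?_, ?_⟩
  · rw [Pi.add_apply, mul_add]; exact (hf.deriv₄ x hx).add (hg.deriv₄ x hx)
  · simp [hf.zero₂, hg.zero₂]
  · simp [hf.one₂, hg.one₂]
  · simp [hf.zero₃, hg.zero₃]
  · simp [hf.one₃, hg.one₃]

theorem smul (a : ℝ) (hf : IsFreeBeam r f f₁ f₂ f₃) :
    IsFreeBeam r (a • f) (a • f₁) (a • f₂) (a • f₃) := by
  refine ⟨fun x hx => (hf.deriv₁ x hx).const_smul a, fun x hx => (hf.deriv₂ x hx).const_smul a,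
    fun x hx => (hf.deriv₃ x hx).const_smul a, fun x hx => ?_, ?_, ?_, ?_, ?_⟩
  · rw [Pi.smul_apply, mul_smul_comm]; exact (hf.deriv₄ x hx).const_smul a
  · simp [hf.zero₂]
  · simp [hf.one₂]
  · simp [hf.zero₃]
  · simp [hf.one₃]

theorem zero (r : ℝ) : IsFreeBeam r 0 0 0 0 := by
  have h : ∀ x : ℝ, HasDerivWithinAt (0 : ℝ → ℝ) 0 (Icc 0 1) x := fun x =>
    hasDerivWithinAt_const x _ 0
  refine ⟨fun x _ => h x, fun x _ => h x, fun x _ => h x, fun x _ => ?_, rfl, rfl, rfl, rfl⟩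
  simpa using h x

end IsFreeBeam

/-- The solutions of the free beam problem for the parameter `r`, as a subspace of `L²`. -/
noncomputable def beamSpace (r : ℝ) : Submodule ℝ L2Unit where
  carrier := {u | ∃ g g₁ g₂ g₃, IsFreeBeam r g g₁ g₂ g₃ ∧ u = l2 g}
  add_mem' := by
    rintro _ _ ⟨f, f₁, f₂, f₃, hf, rfl⟩ ⟨g, g₁, g₂, g₃, hg, rfl⟩
    exact ⟨_, _, _, _, hf.add hg,
      (l2_add (memLp_of_continuousOn hf.cont) (memLp_of_continuousOn hg.cont)).symm⟩
  zero_mem' := ⟨_, _, _, _, IsFreeBeam.zero r, eq_l2_of_ae (Lp.coeFn_zero _ _ _)⟩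
  smul_mem' := by
    rintro a _ ⟨f, f₁, f₂, f₃, hf, rfl⟩
    exact ⟨_, _, _, _, hf.smul a, (l2_smul a (memLp_of_continuousOn hf.cont)).symm⟩

theorem mem_beamSpace {r : ℝ} {g g₁ g₂ g₃ : ℝ → ℝ} (h : IsFreeBeam r g g₁ g₂ g₃) :
    l2 g ∈ beamSpace r := ⟨g, g₁, g₂, g₃, h, rfl⟩

/-- A maximal orthonormal set is a beam system with all eigenvalues equal to `r`, hence finite by
the counting bound. Its span is then complete, and maximality makes it the whole space. -/
instance (r : ℝ) : FiniteDimensional ℝ (beamSpace r) := by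
  obtain ⟨w, -, hw, hmax⟩ := exists_maximal_orthonormal (𝕜 := ℝ) (E := beamSpace r)
    (s := ∅) (by simp [Orthonormal, Pairwise])
  rw [maximal_orthonormal_iff_orthogonalComplement_eq_bot hw] at hmax
  choose φ φ₁ φ₂ φ₃ hφ hl using fun i : w => (i : beamSpace r).2
  have hin : ∀ i j : w, ∫ x in (0 : ℝ)..1, φ i x * φ j x
      = ⟪(i : beamSpace r), (j : beamSpace r)⟫_ℝ := fun i j => by
    rw [← inner_l2 (memLp_of_continuousOn (hφ i).cont) (memLp_of_continuousOn (hφ j).cont),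
      ← hl, ← hl]
    rfl
  have hs : IsBeamSystem φ φ₁ φ₂ φ₃ (fun _ => r) := by
    refine ⟨hφ, fun i => ?_, fun i j hij => ?_⟩
    · rw [hin, real_inner_self_eq_norm_sq, hw.1 i, one_pow]
    · rw [hin]; exact hw.2 hij
  have hfin : w.Finite := by
    have h : (Set.univ : Set w).Finite := (hs.finite_le r).subset fun _ _ => le_refl r
    exact Set.finite_coe_iff.1 (Set.finite_univ_iff.1 h)
  have : FiniteDimensional ℝ (Submodule.span ℝ w) := FiniteDimensional.span_of_finite ℝ hfin
  have : CompleteSpace (Submodule.span ℝ w) := FiniteDimensional.complete ℝ _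
  have : (Submodule.span ℝ w).HasOrthogonalProjection :=
    Submodule.HasOrthogonalProjection.ofCompleteSpace _
  rw [Submodule.orthogonal_eq_bot_iff] at hmax
  exact ⟨(Submodule.fg_def).2 ⟨w, hfin, hmax⟩⟩

theorem eqOn_of_l2_eq {f g : ℝ → ℝ} (hf : ContinuousOn f (Icc 0 1)) (hg : ContinuousOn g (Icc 0 1))
    (h : l2 f = l2 g) : EqOn f g (Icc 0 1) := by
  refine Measure.eqOn_Icc_of_ae_eq volume zero_ne_one ?_ hf hg
  have h1 := coeFn_l2 (memLp_of_continuousOn hf)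
  have h2 := coeFn_l2 (memLp_of_continuousOn hg)
  rw [h] at h1
  exact h1.symm.trans h2

/-- A complete orthonormal system of solutions that exhausts the solution spaces. -/
theorem exists_isBeamSystem :
    ∃ (ι : Type) (φ φ₁ φ₂ φ₃ : ι → ℝ → ℝ) (ρ : ι → ℝ), IsBeamSystem φ φ₁ φ₂ φ₃ ρ ∧
      IsBeamSystem.Complete φ ∧ ∀ r g g₁ g₂ g₃, IsFreeBeam r g g₁ g₂ g₃ →
        ∃ p ∈ Submodule.span ℝ (φ '' {i | ρ i = r}), EqOn g p (Icc 0 1) := by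
  -- Collect orthonormal bases over all real `r`; parameters that are not eigenvalues contribute
  -- empty bases.
  let b := fun r : ℝ => stdOrthonormalBasis ℝ (beamSpace r)
  choose φ φ₁ φ₂ φ₃ hφ hl using
    fun i : Σ r : ℝ, Fin (Module.finrank ℝ (beamSpace r)) => (b i.1 i.2).2
  have hs : IsBeamSystem φ φ₁ φ₂ φ₃ (fun i => i.1) := by
    have hin : ∀ i j, ∫ x in (0 : ℝ)..1, φ i x * φ j x
        = ⟪(b i.1 i.2 : L2Unit), (b j.1 j.2 : L2Unit)⟫_ℝ := fun i j => by
      rw [← inner_l2 (memLp_of_continuousOn (hφ i).cont) (memLp_of_continuousOn (hφ j).cont),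
        ← hl, ← hl]
    refine ⟨hφ, fun i => ?_, fun i j hij => ?_⟩
    · rw [hin, real_inner_self_eq_norm_sq]
      have : ‖((b i.1) i.2 : L2Unit)‖ = 1 := (b i.1).orthonormal.1 i.2
      rw [this, one_pow]
    · rcases i with ⟨r, k⟩
      rcases j with ⟨s, l⟩
      rcases eq_or_ne r s with rfl | hrs
      · rw [hin]
        refine (b r).orthonormal.2 fun hkl => hij ?_
        exact congrArg (Sigma.mk r) hkl
      · exact (hφ ⟨r, k⟩).integral_mul_eq_zero (hφ ⟨s, l⟩) hrs
  have hexp : ∀ r g g₁ g₂ g₃, IsFreeBeam r g g₁ g₂ g₃ →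
      ∃ a : Fin (Module.finrank ℝ (beamSpace r)) → ℝ, l2 g = ∑ k, a k • l2 (φ ⟨r, k⟩) := by
    intro r g g₁ g₂ g₃ hg
    have h := congrArg Subtype.val ((b r).sum_repr ⟨l2 g, mem_beamSpace hg⟩)
    refine ⟨fun k => (b r).repr ⟨l2 g, mem_beamSpace hg⟩ k, ?_⟩
    rw [Submodule.coe_sum] at h
    refine (show _ = l2 g from h).symm.trans ?_
    exact Finset.sum_congr rfl fun k _ => by rw [Submodule.coe_smul, ← hl ⟨r, k⟩]
  refine ⟨_, φ, φ₁, φ₂, φ₃, _, hs, fun u hu => ?_, fun r g g₁ g₂ g₃ hg => ?_⟩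
  · refine eq_zero_of_forall_inner_isFreeBeam fun r g g₁ g₂ g₃ hg => ?_
    obtain ⟨a, ha⟩ := hexp r g g₁ g₂ g₃ hg
    rw [ha, sum_inner]
    exact Finset.sum_eq_zero fun k _ => by rw [inner_smul_left, hu, mul_zero]
  · obtain ⟨a, ha⟩ := hexp r g g₁ g₂ g₃ hg
    refine ⟨∑ k, a k • φ ⟨r, k⟩, Submodule.sum_mem _ fun k _ => Submodule.smul_mem _ _
      (Submodule.subset_span ⟨⟨r, k⟩, rfl, rfl⟩), ?_⟩
    refine eqOn_of_l2_eq hg.cont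
      (HasTwoDerivs.sum (fun k => (hφ ⟨r, k⟩).hasTwoDerivs) a Finset.univ).cont ?_
    rw [ha, l2_sum fun k => hs.memLp ⟨r, k⟩]

/-- A function on an infinite type with finite sublevel sets can be listed in nondecreasing
order. -/
theorem exists_equiv_monotone {ι : Type*} [Infinite ι] (v : ι → ℝ)
    (hfin : ∀ R, {i | v i ≤ R}.Finite) : ∃ e : ℕ ≃ ι, Monotone (v ∘ e) := by
  classical
  have : Countable ι := by
    have h : (⋃ n : ℕ, {i | v i ≤ n}) = Set.univ :=
      Set.eq_univ_of_forall fun i => Set.mem_iUnion.2 (exists_nat_ge (v i))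
    rw [← Set.countable_univ_iff, ← h]
    exact Set.countable_iUnion fun n => (hfin n).countable
  obtain ⟨f, hf⟩ := exists_injective_nat ι
  -- Break ties by an injection into `ℕ`, giving a strict total order with finite initial segments.
  -- Counting predecessors embeds it in `ℕ`, and enumerating the infinite range avoids showing that
  -- the count is onto.
  let lt : ι → ι → Prop := fun i j => v i < v j ∨ v i = v j ∧ f i < f j
  let rank : ι → ℕ := fun i => {j | lt j i}.ncard
  have hlt : ∀ i j, lt i j → rank i < rank j := by
    intro i j hij
    refine Set.ncard_lt_ncard ⟨fun k hk => ?_, fun hsub => ?_⟩ ((hfin (v j)).subset fun k hk => ?_)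
    · rcases hk with hk | hk <;> rcases hij with hij | hij
      · exact Or.inl (hk.trans hij)
      · exact Or.inl (hij.1 ▸ hk)
      · exact Or.inl (hk.1 ▸ hij)
      · exact Or.inr ⟨hk.1.trans hij.1, hk.2.trans hij.2⟩
    · rcases hsub hij with h | h
      · exact lt_irrefl _ h
      · exact lt_irrefl _ h.2
    · rcases hk with hk | hk
      · exact hk.le
      · exact hk.1.le
  have hinj : Function.Injective rank := by
    intro i j hij
    by_contra hne
    have hfne : f i ≠ f j := fun h => hne (hf h)
    have : lt i j ∨ lt j i := by
      rcases lt_trichotomy (v i) (v j) with h | h | h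
      · exact Or.inl (Or.inl h)
      · rcases lt_or_gt_of_ne hfne with h' | h'
        · exact Or.inl (Or.inr ⟨h, h'⟩)
        · exact Or.inr (Or.inr ⟨h.symm, h'⟩)
      · exact Or.inr (Or.inl h)
    rcases this with h | h
    · exact absurd hij (hlt _ _ h).ne
    · exact absurd hij (hlt _ _ h).ne'
  have : Infinite (Set.range rank) := (Set.infinite_range_of_injective hinj).to_subtype
  let o := Nat.Subtype.orderIsoOfNat (Set.range rank)
  let q := Equiv.ofInjective rank hinj
  refine ⟨o.toEquiv.trans q.symm, fun m n hmn => ?_⟩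
  by_contra hcon
  have h1 := hlt _ _ (Or.inl (not_le.1 hcon))
  have h2 : ∀ m, rank (q.symm (o m)) = o m := fun m =>
    congrArg Subtype.val (q.apply_symm_apply (o m))
  have h3 : rank (q.symm (o n)) < rank (q.symm (o m)) := h1
  rw [h2, h2] at h3
  exact absurd (o.monotone hmn) (not_le.2 h3)

section EigenSystem

variable {A f₀ dens : ℝ → ℝ}

theorem formV_eq (hA : ∀ t, iteratedDeriv 2 A t = 1) (hd : IsUniformDensity dens)
    (g g' : ℝ → ℝ) : formV A f₀ dens g g' = ∫ x in (0 : ℝ)..1, g x * g' x := by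
  refine intervalIntegral.integral_congr fun x hx => ?_
  rw [uIcc_of_le zero_le_one] at hx
  simp only [hA, hd x hx, one_mul, mul_one]

theorem exists_isEigenSystem (hA : ∀ t, iteratedDeriv 2 A t = 1) (hd : IsUniformDensity dens) :
    ∃ φ ρ, IsEigenSystem 2 A f₀ dens φ ρ := by
  obtain ⟨ι, φ, φ₁, φ₂, φ₃, ρ, hs, hc, hex⟩ := exists_isBeamSystem
  have := hs.infinite hc
  obtain ⟨e, he⟩ := exists_equiv_monotone ρ hs.finite_le
  refine ⟨φ ∘ e, ρ ∘ e, he, fun ν => ?_, fun μ ν => ?_, fun r g hg => ?_⟩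
  · exact (solvesEigenproblem_iff hA hd).2 ⟨_, _, _, hs.beam (e ν)⟩
  · rw [formV_eq hA hd]
    split_ifs with h
    · rw [h]; exact hs.norm_one _
    · exact hs.orthogonal _ _ fun h' => h (e.injective h')
  · obtain ⟨g₁, g₂, g₃, hg⟩ := (solvesEigenproblem_iff hA hd).1 hg
    obtain ⟨p, hp, hgp⟩ := hex r g g₁ g₂ g₃ hg
    refine ⟨p, ?_, hgp⟩
    convert! hp using 2
    ext q
    constructor
    · rintro ⟨ν, hν, rfl⟩; exact ⟨e ν, hν, rfl⟩
    · rintro ⟨i, hi, rfl⟩; exact ⟨e.symm i, by simpa using hi, by simp⟩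

/-- Completeness follows from exhaustiveness: a vector orthogonal to every `φ ν` is orthogonal to
every beam solution, hence zero. -/
theorem IsEigenSystem.exists_isBeamSystem (hA : ∀ t, iteratedDeriv 2 A t = 1)
    (hd : IsUniformDensity dens) {φ : ℕ → ℝ → ℝ} {ρ : ℕ → ℝ} (h : IsEigenSystem 2 A f₀ dens φ ρ) :
    (∃ φ₁ φ₂ φ₃, IsBeamSystem φ φ₁ φ₂ φ₃ ρ) ∧ IsBeamSystem.Complete φ := by
  choose φ₁ φ₂ φ₃ hφ using fun ν => (solvesEigenproblem_iff hA hd).1 (h.solves ν)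
  refine ⟨⟨φ₁, φ₂, φ₃, hφ, fun ν => ?_, fun μ ν hμν => ?_⟩, fun u hu => ?_⟩
  · rw [← formV_eq (f₀ := f₀) hA hd, h.orthonormal, if_pos rfl]
  · rw [← formV_eq (f₀ := f₀) hA hd, h.orthonormal, if_neg hμν]
  · refine eq_zero_of_forall_inner_isFreeBeam fun r g g₁ g₂ g₃ hg => ?_
    obtain ⟨p, hp, hgp⟩ := h.exhaustive r g ((solvesEigenproblem_iff hA hd).2 ⟨_, _, _, hg⟩)
    rw [l2_congr (memLp_of_continuousOn hg.cont) hgp]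
    clear hgp
    have key : MemLp p 2 unitMeasure ∧ ⟪l2 p, u⟫_ℝ = 0 := by
      induction hp using Submodule.span_induction with
      | mem x hx =>
        obtain ⟨ν, -, rfl⟩ := hx
        exact ⟨memLp_of_continuousOn (hφ ν).cont, hu ν⟩
      | zero =>
        have h0 : MemLp (0 : ℝ → ℝ) 2 unitMeasure := MemLp.zero
        refine ⟨h0, ?_⟩
        rw [show l2 0 = 0 from (eq_l2_of_ae (Lp.coeFn_zero _ _ _)).symm, inner_zero_left]
      | add x y _ _ hx hy =>
        refine ⟨hx.1.add hy.1, ?_⟩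
        rw [l2_add hx.1 hy.1, inner_add_left, hx.2, hy.2, add_zero]
      | smul a x _ hx =>
        refine ⟨hx.1.const_smul a, ?_⟩
        rw [l2_smul a hx.1, inner_smul_left, hx.2, mul_zero]
    exact key.2

end EigenSystem

/-! ### The rate conditions -/

section Rates

variable {β : ℝ} {sigSq : ℕ → ℝ} {lam : ℕ → ℝ} {φ : ℕ → ℝ → ℝ} {ρ : ℕ → ℝ}

/-- The denominators of `θ_{1,n}²`. -/
noncomputable def denom (β : ℝ) (sigSq : ℕ → ℝ) (lam : ℕ → ℝ) (ρ : ℕ → ℝ) (n ν : ℕ) : ℝ :=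
  tauSq 2 β sigSq ρ ν + n * (1 + lam n * gam 2 ρ ν)

theorem tauSq_nonneg (hsig : ∀ ν < 2, 0 < sigSq ν) (hρ : ∀ ν, 0 ≤ ρ ν) (ν : ℕ) :
    0 ≤ tauSq 2 β sigSq ρ ν := by
  unfold tauSq
  split_ifs with h
  · exact (inv_pos.2 (hsig ν h)).le
  · exact Real.rpow_nonneg (hρ ν) _

theorem gam_nonneg (hρ : ∀ ν, 0 ≤ ρ ν) (ν : ℕ) : 0 ≤ gam 2 ρ ν := by
  unfold gam
  split_ifs
  · exact zero_le_one
  · exact hρ ν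

theorem le_denom (hsig : ∀ ν < 2, 0 < sigSq ν) (hρ : ∀ ν, 0 ≤ ρ ν) (n ν : ℕ) :
    n * (1 + lam n * gam 2 ρ ν) ≤ denom β sigSq lam ρ n ν :=
  le_add_of_nonneg_left (tauSq_nonneg hsig hρ ν)

theorem cast_le_denom (hsig : ∀ ν < 2, 0 < sigSq ν) (hρ : ∀ ν, 0 ≤ ρ ν) {n : ℕ}
    (hlam : 0 < lam n) (ν : ℕ) : (n : ℝ) ≤ denom β sigSq lam ρ n ν := by
  refine le_trans ?_ (le_denom hsig hρ n ν)
  have := mul_nonneg hlam.le (gam_nonneg hρ ν)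
  exact le_mul_of_one_le_right (Nat.cast_nonneg n) (by linarith)

theorem thetaTerm_nonneg (hsig : ∀ ν < 2, 0 < sigSq ν) (hρ : ∀ ν, 0 ≤ ρ ν) {n : ℕ}
    (hlam : 0 < lam n) (F : (ℝ → ℝ) → ℝ) (k ν : ℕ) :
    0 ≤ thetaTerm 2 β sigSq lam φ ρ F k n ν :=
  div_nonneg (sq_nonneg _)
    (pow_nonneg ((Nat.cast_nonneg n).trans (cast_le_denom hsig hρ hlam ν)) k)

theorem pow_mul_thetaTerm_le {n : ℕ} (hn : 1 ≤ n) (F : (ℝ → ℝ) → ℝ) (k ν : ℕ) {t : ℝ} (ht : 0 < t)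
    (h : n * t ≤ denom β sigSq lam ρ n ν) :
    n ^ k * thetaTerm 2 β sigSq lam φ ρ F k n ν ≤ F (φ ν) ^ 2 / t ^ k := by
  have hn0 : (0 : ℝ) < n := by exact_mod_cast hn
  have hd : 0 < denom β sigSq lam ρ n ν := lt_of_lt_of_le (by positivity) h
  change (n : ℝ) ^ k * (F (φ ν) ^ 2 / denom β sigSq lam ρ n ν ^ k) ≤ _
  rw [← mul_div_assoc, div_le_div_iff₀ (by positivity) (by positivity)]
  have := pow_le_pow_left₀ (by positivity) h k
  rw [mul_pow] at this
  nlinarith [mul_le_mul_of_nonneg_left this (sq_nonneg (F (φ ν)))]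

theorem le_pow_mul_thetaTerm (hsig : ∀ ν < 2, 0 < sigSq ν) (hρ : ∀ ν, 0 ≤ ρ ν) {n : ℕ}
    (hlam : 0 < lam n) (hn : 1 ≤ n) (F : (ℝ → ℝ) → ℝ) (k ν : ℕ) {t : ℝ} (ht : 0 < t)
    (h : denom β sigSq lam ρ n ν ≤ n * t) :
    F (φ ν) ^ 2 / t ^ k ≤ n ^ k * thetaTerm 2 β sigSq lam φ ρ F k n ν := by
  have hn0 : (0 : ℝ) < n := by exact_mod_cast hn
  have hd : 0 < denom β sigSq lam ρ n ν := lt_of_lt_of_le hn0 (cast_le_denom hsig hρ hlam ν)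
  change _ ≤ (n : ℝ) ^ k * (F (φ ν) ^ 2 / denom β sigSq lam ρ n ν ^ k)
  rw [← mul_div_assoc, div_le_div_iff₀ (by positivity) (by positivity)]
  have := pow_le_pow_left₀ hd.le h k
  rw [mul_pow] at this
  nlinarith [mul_le_mul_of_nonneg_left this (sq_nonneg (F (φ ν)))]

theorem bandwidth_pos {n : ℕ} (h : 0 < lam n) : 0 < bandwidth 2 lam n := Real.rpow_pos_of_pos h _

theorem bandwidth_pow {n : ℕ} (h : 0 < lam n) : bandwidth 2 lam n ^ 4 = lam n := by
  rw [bandwidth, ← Real.rpow_natCast, ← Real.rpow_mul h.le]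
  norm_num

theorem tendsto_bandwidth (hβ : 1 < β)
    (hh : bandwidth 2 lam =Θ[atTop] (fun n : ℕ => (n : ℝ) ^ (-(1 / (2 * 2 + β))))) :
    Tendsto (bandwidth 2 lam) atTop (𝓝 0) := by
  refine hh.1.trans_tendsto ?_
  exact (tendsto_rpow_neg_atTop (by positivity)).comp tendsto_natCast_atTop_atTop

/-- The rate condition with exponent `0`. -/
theorem rateCondition_zero (hsig : ∀ ν < 2, 0 < sigSq ν) (hρ : ∀ ν, 0 ≤ ρ ν)
    (hlam : ∀ n : ℕ, 1 ≤ n → 0 < lam n) (hlim : Tendsto (bandwidth 2 lam) atTop (𝓝 0))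
    {F : (ℝ → ℝ) → ℝ} (hF : Summable fun ν => F (φ ν) ^ 2) (hF0 : 0 < ∑' ν, F (φ ν) ^ 2) :
    RateCondition 2 β sigSq lam φ ρ F 0 := by
  intro k _
  have hle : ∀ n : ℕ, 1 ≤ n → ∀ ν,
      n ^ k * thetaTerm 2 β sigSq lam φ ρ F k n ν ≤ F (φ ν) ^ 2 := fun n hn ν => by
    have := pow_mul_thetaTerm_le (φ := φ) hn F k ν zero_lt_one
      (by rw [mul_one]; exact cast_le_denom (β := β) hsig hρ (hlam n hn) ν)
    simpa using this
  have hsum' : ∀ n : ℕ, 1 ≤ n →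
      Summable fun ν => (n : ℝ) ^ k * thetaTerm 2 β sigSq lam φ ρ F k n ν := fun n hn =>
    Summable.of_nonneg_of_le (fun ν => mul_nonneg (by positivity)
      (thetaTerm_nonneg hsig hρ (hlam n hn) F k ν)) (hle n hn) hF
  have hsum : ∀ n : ℕ, 1 ≤ n → Summable (thetaTerm 2 β sigSq lam φ ρ F k n) := fun n hn => by
    have hn0 : (n : ℝ) ^ k ≠ 0 := by positivity
    exact (summable_mul_left_iff hn0).1 (hsum' n hn)
  refine ⟨hsum, ?_⟩
  simp only [neg_zero, Real.rpow_zero]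
  obtain ⟨ν, hν⟩ : ∃ ν, F (φ ν) ^ 2 ≠ 0 := by
    by_contra! hcon
    simp [hcon] at hF0
  have hν : 0 < F (φ ν) ^ 2 := lt_of_le_of_ne (sq_nonneg _) hν.symm
  have hτ := tauSq_nonneg (β := β) hsig hρ ν
  have hγ := gam_nonneg hρ ν
  -- Once `λ_n ≤ 1`, `n t` dominates the denominator at this fixed index, so a single term gives the
  -- lower bound.
  set t : ℝ := tauSq 2 β sigSq ρ ν + 1 + gam 2 ρ ν with ht
  have ht0 : 0 < t := by positivity
  refine ⟨IsBigO.of_bound (∑' ν, F (φ ν) ^ 2) ?_, IsBigO.of_bound (t ^ k / F (φ ν) ^ 2) ?_⟩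
  · filter_upwards [eventually_ge_atTop 1] with n hn
    have h0 : 0 ≤ (n : ℝ) ^ k * thetaSq 2 β sigSq lam φ ρ F k n :=
      mul_nonneg (by positivity) (tsum_nonneg fun ν => thetaTerm_nonneg hsig hρ (hlam n hn) F k ν)
    rw [Real.norm_of_nonneg h0, norm_one, mul_one, thetaSq, ← tsum_mul_left]
    exact (hsum' n hn).tsum_le_tsum (hle n hn) hF
  · filter_upwards [eventually_ge_atTop 1, hlim.eventually (ge_mem_nhds zero_lt_one)] with n hn hb
    have h0 : 0 ≤ (n : ℝ) ^ k * thetaSq 2 β sigSq lam φ ρ F k n :=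
      mul_nonneg (by positivity) (tsum_nonneg fun ν => thetaTerm_nonneg hsig hρ (hlam n hn) F k ν)
    have hl1 : lam n ≤ 1 := by
      rw [← bandwidth_pow (hlam n hn)]
      exact pow_le_one₀ (bandwidth_pos (hlam n hn)).le hb
    have hn1 : (1 : ℝ) ≤ n := by exact_mod_cast hn
    have hd : denom β sigSq lam ρ n ν ≤ n * t := by
      have h1 : lam n * gam 2 ρ ν ≤ gam 2 ρ ν := mul_le_of_le_one_left hγ hl1
      have h2 : tauSq 2 β sigSq ρ ν ≤ n * tauSq 2 β sigSq ρ ν := le_mul_of_one_le_left hτ hn1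
      have h3 : (n : ℝ) * (1 + lam n * gam 2 ρ ν) ≤ n * (1 + gam 2 ρ ν) := by gcongr
      rw [denom, ht]; nlinarith
    have h4 := le_pow_mul_thetaTerm (φ := φ) hsig hρ (hlam n hn) hn F k ν ht0 hd
    have h5 : (n : ℝ) ^ k * thetaTerm 2 β sigSq lam φ ρ F k n ν
        ≤ (n : ℝ) ^ k * thetaSq 2 β sigSq lam φ ρ F k n :=
      mul_le_mul_of_nonneg_left ((hsum n hn).le_tsum ν fun j _ =>
        thetaTerm_nonneg hsig hρ (hlam n hn) F k j) (by positivity)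
    rw [Real.norm_of_nonneg h0, norm_one]
    have h6 := mul_le_mul_of_nonneg_left (h4.trans h5) (by positivity : 0 ≤ t ^ k / F (φ ν) ^ 2)
    have e : t ^ k / F (φ ν) ^ 2 * (F (φ ν) ^ 2 / t ^ k) = 1 := by
      rw [div_mul_div_comm, mul_comm, div_self (by positivity)]
    rwa [e] at h6

variable {φ₁ φ₂ φ₃ : ℕ → ℝ → ℝ}

/-- After dropping `τ_ν²`, the terms are dominated by those of the kernel at bandwidth `h`, the
power `k` only helping because the normalized denominators are at least `1`. The first two indices,
where `γ_ν` is `1` instead of `ρ_ν`, are bounded separately. -/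
theorem sum_pow_mul_thetaTerm_eval_le (hs : IsBeamSystem φ φ₁ φ₂ φ₃ ρ)
    (hsig : ∀ ν < 2, 0 < sigSq ν) {n : ℕ} (hlam : 0 < lam n) (hn : 1 ≤ n) {z : ℝ}
    (hz : z ∈ Icc (0 : ℝ) 1) {k : ℕ} (hk : 1 ≤ k) {h : ℝ} (h0 : 0 < h) (h1 : h ≤ 1 / 2)
    (hhl : h ^ 4 ≤ lam n) (S : Finset ℕ) :
    ∑ ν ∈ S, (n : ℝ) ^ k * thetaTerm 2 β sigSq lam φ ρ (evalFunctional z) k n ν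
      ≤ ∑ ν ∈ Finset.range 2, φ ν z ^ 2 + 32 / h := by
  classical
  have hρ := hs.nonneg
  have hle : ∀ ν, (n : ℝ) ^ k * thetaTerm 2 β sigSq lam φ ρ (evalFunctional z) k n ν
      ≤ (if ν ∈ Finset.range 2 then φ ν z ^ 2 else 0) + φ ν z ^ 2 / (1 + h ^ 4 * ρ ν) := fun ν => by
    have hr : 0 ≤ h ^ 4 * ρ ν := mul_nonneg (by positivity) (hρ ν)
    split_ifs with hν
    · have := pow_mul_thetaTerm_le (φ := φ) hn (evalFunctional z) k ν zero_lt_one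
        (by rw [mul_one]; exact cast_le_denom (β := β) hsig hρ hlam ν)
      rw [one_pow, div_one] at this
      exact this.trans (le_add_of_nonneg_right (by positivity))
    · have hg : gam 2 ρ ν = ρ ν := if_neg (by simpa using hν)
      have hle1 : 1 + h ^ 4 * ρ ν ≤ 1 + lam n * gam 2 ρ ν := by
        rw [hg]; have := mul_le_mul_of_nonneg_right hhl (hρ ν); linarith
      have := pow_mul_thetaTerm_le (φ := φ) hn (evalFunctional z) k ν
        (t := 1 + h ^ 4 * ρ ν) (by positivity)
        ((mul_le_mul_of_nonneg_left hle1 (Nat.cast_nonneg n)).trans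
          (le_denom (β := β) hsig hρ n ν))
      rw [zero_add]
      refine this.trans (div_le_div_of_nonneg_left (sq_nonneg _) (by positivity) ?_)
      exact le_self_pow₀ (by linarith) (by omega)
  refine (Finset.sum_le_sum fun ν _ => hle ν).trans ?_
  rw [Finset.sum_add_distrib]
  refine add_le_add ?_ (hs.sum_sq_div_le hz h0 h1 S)
  rw [← Finset.sum_filter]
  refine Finset.sum_le_sum_of_subset_of_nonneg (fun ν hν => (Finset.mem_filter.1 hν).2)
    fun ν _ _ => sq_nonneg _

/-- The rate condition for evaluation functionals. -/
theorem rateCondition_eval (hs : IsBeamSystem φ φ₁ φ₂ φ₃ ρ) (hc : IsBeamSystem.Complete φ)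
    (hβ : 1 < β) (hsig : ∀ ν < 2, 0 < sigSq ν) (hlam : ∀ n : ℕ, 1 ≤ n → 0 < lam n)
    (hh : bandwidth 2 lam =Θ[atTop] (fun n : ℕ => (n : ℝ) ^ (-(1 / (2 * 2 + β)))))
    {z : ℝ} (hz : z ∈ Icc (0 : ℝ) 1) : RateCondition 2 β sigSq lam φ ρ (evalFunctional z) 1 := by
  intro k hk
  have hk1 : 1 ≤ k := by omega
  have hρ := hs.nonneg
  have hlim := tendsto_bandwidth hβ hh
  set F := evalFunctional z with hF
  set C := ∑ ν ∈ Finset.range 2, φ ν z ^ 2 with hC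
  have hC0 : 0 ≤ C := Finset.sum_nonneg fun ν _ => sq_nonneg _
  have hnn : ∀ n : ℕ, 1 ≤ n → ∀ ν, 0 ≤ (n : ℝ) ^ k * thetaTerm 2 β sigSq lam φ ρ F k n ν :=
    fun n hn ν => mul_nonneg (by positivity) (thetaTerm_nonneg hsig hρ (hlam n hn) F k ν)
  have hsum' : ∀ n : ℕ, 1 ≤ n →
      Summable fun ν => (n : ℝ) ^ k * thetaTerm 2 β sigSq lam φ ρ F k n ν := fun n hn => by
    have hb := bandwidth_pos (hlam n hn)
    refine summable_of_sum_le (hnn n hn) fun S =>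
      sum_pow_mul_thetaTerm_eval_le hs hsig (hlam n hn) hn hz hk1
        -- Summability is claimed for every `n ≥ 1`, including those whose bandwidth exceeds the
        -- range of the Sobolev inequality.
        (h := min (bandwidth 2 lam n) (1 / 2)) (lt_min hb (by norm_num)) (min_le_right _ _) ?_ S
    rw [← bandwidth_pow (hlam n hn)]
    exact pow_le_pow_left₀ (le_min hb.le (by norm_num)) (min_le_left _ _) 4
  refine ⟨fun n hn => ?_, IsBigO.of_bound (C + 32) ?_, ?_⟩
  · have hn0 : (n : ℝ) ^ k ≠ 0 := by positivity
    exact (summable_mul_left_iff hn0).1 (hsum' n hn)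
  · filter_upwards [eventually_ge_atTop 1,
      hlim.eventually (ge_mem_nhds (show (0 : ℝ) < 1 / 2 by norm_num))] with n hn hb2
    have hb := bandwidth_pos (hlam n hn)
    have key : ∑' ν, (n : ℝ) ^ k * thetaTerm 2 β sigSq lam φ ρ F k n ν
        ≤ C + 32 / bandwidth 2 lam n :=
      (hsum' n hn).tsum_le_of_sum_le fun S =>
        sum_pow_mul_thetaTerm_eval_le hs hsig (hlam n hn) hn hz hk1 hb hb2
          (bandwidth_pow (hlam n hn)).le S
    have h0 : 0 ≤ ∑' ν, (n : ℝ) ^ k * thetaTerm 2 β sigSq lam φ ρ F k n ν := tsum_nonneg (hnn n hn)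
    rw [tsum_mul_left] at key h0
    rw [Real.rpow_neg_one, thetaSq, Real.norm_of_nonneg h0,
      Real.norm_of_nonneg (inv_nonneg.2 hb.le)]
    refine key.trans ?_
    have h1 : 1 ≤ (bandwidth 2 lam n)⁻¹ := (one_le_inv₀ hb).2 (by linarith)
    rw [div_eq_mul_inv]
    nlinarith
  · obtain ⟨c, hc0, hcb⟩ := hh.2.exists_pos
    have hβ4 : 0 < 4 + β := by linarith
    -- The first summand controls `τ_ν² / n` and the second `1 + λ_n ρ_ν` when `ρ_ν ≤ (40/h)⁴`.
    set K : ℝ := (40 * c) ^ (4 + β) + (1 + 40 ^ 4) with hK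
    have hK0 : 0 < K := by positivity
    refine IsBigO.of_bound (2000 * K ^ k) ?_
    filter_upwards [eventually_ge_atTop 1, hcb.bound,
      hlim.eventually (ge_mem_nhds (show (0 : ℝ) < 1 by norm_num)),
      hlim.eventually (ge_mem_nhds (show (0 : ℝ) < 1 / (2000 * (C + 1)) by positivity))]
      with n hn hbn hb1 hbC
    have hb := bandwidth_pos (hlam n hn)
    have hbl := bandwidth_pow (hlam n hn)
    have h0 : 0 ≤ ∑' ν, (n : ℝ) ^ k * thetaTerm 2 β sigSq lam φ ρ F k n ν := tsum_nonneg (hnn n hn)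
    have hle : ∀ S : Finset ℕ, ∑ ν ∈ S, (n : ℝ) ^ k * thetaTerm 2 β sigSq lam φ ρ F k n ν
        ≤ ∑' ν, (n : ℝ) ^ k * thetaTerm 2 β sigSq lam φ ρ F k n ν := fun S =>
      (hsum' n hn).sum_le_tsum S fun ν _ => hnn n hn ν
    rw [tsum_mul_left] at h0 hle
    rw [Real.rpow_neg_one, thetaSq, Real.norm_of_nonneg h0,
      Real.norm_of_nonneg (inv_nonneg.2 hb.le)]
    have hn0 : (0 : ℝ) < n := by exact_mod_cast hn
    rw [Real.norm_of_nonneg (by positivity), Real.norm_of_nonneg hb.le] at hbn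
    obtain ⟨S, hS, hSsum⟩ := hs.exists_sum_sq_ge hc hz hb hb1
    set b := bandwidth 2 lam n with hbdef
    -- The choice of bandwidth enters here: `1/h` is at most of order `n^(1/(4+β))`, exactly what
    -- keeps `τ_ν²` of order at most `n` below the cutoff.
    have hτ : (40 / b) ^ (4 + β) ≤ (40 * c) ^ (4 + β) * n := by
      have e1 : b⁻¹ ≤ c * (n : ℝ) ^ (1 / (4 + β)) := by
        have e : (n : ℝ) ^ (-(1 / (2 * 2 + β))) = ((n : ℝ) ^ (1 / (4 + β)))⁻¹ := by
          rw [Real.rpow_neg hn0.le]; norm_num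
        rw [e] at hbn
        have hp : 0 < (n : ℝ) ^ (1 / (4 + β)) := by positivity
        rw [inv_le_iff_one_le_mul₀ hb]
        rw [inv_le_iff_one_le_mul₀ hp] at hbn
        linarith
      have e2 : 40 / b ≤ 40 * c * (n : ℝ) ^ (1 / (4 + β)) := by
        rw [div_eq_mul_inv, mul_assoc]; gcongr
      calc (40 / b) ^ (4 + β) ≤ (40 * c * (n : ℝ) ^ (1 / (4 + β))) ^ (4 + β) :=
            Real.rpow_le_rpow (by positivity) e2 hβ4.le
        _ = _ := by
            rw [Real.mul_rpow (by positivity) (by positivity), ← Real.rpow_mul hn0.le,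
              one_div_mul_cancel hβ4.ne', Real.rpow_one]
    have hden : ∀ ν ∈ S, ¬ ν < 2 → denom β sigSq lam ρ n ν ≤ n * K := by
      intro ν hν hν2
      have hr := hS ν hν
      have t1 : tauSq 2 β sigSq ρ ν ≤ (40 / b) ^ (4 + β) := by
        rw [tauSq, if_neg hν2]
        have e : (40 / b) ^ (4 + β) = ((40 / b) ^ 4) ^ (1 + β / (2 * (2 : ℕ))) := by
          rw [← Real.rpow_natCast, ← Real.rpow_mul (by positivity)]
          congr 1; push_cast; ring
        rw [e]
        refine Real.rpow_le_rpow (hρ ν) hr ?_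
        have : 0 < β := by linarith
        positivity
      have t2 : lam n * gam 2 ρ ν ≤ 40 ^ 4 := by
        rw [gam, if_neg hν2, ← hbl]
        calc b ^ 4 * ρ ν ≤ b ^ 4 * (40 / b) ^ 4 := by gcongr
          _ = 40 ^ 4 := by field_simp
      have t3 : (n : ℝ) * (1 + lam n * gam 2 ρ ν) ≤ n * (1 + 40 ^ 4) := by gcongr
      rw [denom, hK]
      linarith
    have hlow : ∑ ν ∈ S with ¬ ν < 2, φ ν z ^ 2 / K ^ k ≤
        ∑ ν ∈ S with ¬ ν < 2, (n : ℝ) ^ k * thetaTerm 2 β sigSq lam φ ρ F k n ν :=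
      Finset.sum_le_sum fun ν hν => by
        have hm := Finset.mem_filter.1 hν
        exact le_pow_mul_thetaTerm hsig hρ (hlam n hn) hn F k ν hK0 (hden ν hm.1 hm.2)
    have hlow2 := hlow.trans (hle _)
    rw [← Finset.sum_div, div_le_iff₀ (by positivity)] at hlow2
    have hfirst : ∑ ν ∈ S with ν < 2, φ ν z ^ 2 ≤ C :=
      Finset.sum_le_sum_of_subset_of_nonneg
        (fun ν hν => Finset.mem_range.2 (Finset.mem_filter.1 hν).2) fun ν _ _ => sq_nonneg _
    rw [← Finset.sum_filter_add_sum_filter_not S (fun ν => ν < 2)] at hSsum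
    -- The two excluded indices cost at most half of the lower bound `1/(1000h)` once `h` is small.
    have hCb : C ≤ 1 / 2000 * b⁻¹ := by
      have e3 : C + 1 ≤ 1 / 2000 * b⁻¹ := by
        rw [← div_eq_mul_inv, le_div_iff₀ hb]
        rw [le_div_iff₀ (by positivity)] at hbC
        linarith
      linarith
    have e4 : 1 / (1000 * b) = 1 / 1000 * b⁻¹ := by rw [one_div, mul_inv, one_div]
    rw [e4] at hSsum
    linarith

theorem integralFunctional_eq_inner {ω : ℝ → ℝ} (hs : IsBeamSystem φ φ₁ φ₂ φ₃ ρ)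
    (hω : MemLp ω 2 unitMeasure) (ν : ℕ) :
    integralFunctional ω (φ ν) = ⟪l2 (φ ν), l2 ω⟫_ℝ :=
  (inner_l2 (hs.memLp ν) hω).symm

/-- The values are the coefficients of `ω` in an orthonormal system: Bessel's inequality gives
summability, and completeness excludes that all vanish. -/
theorem summable_integralFunctional {ω : ℝ → ℝ} (hs : IsBeamSystem φ φ₁ φ₂ φ₃ ρ)
    (hc : IsBeamSystem.Complete φ) (hω : MemLp ω 2 unitMeasure) (h0 : ¬ ω =ᵐ[unitMeasure] 0) :
    Summable (fun ν => integralFunctional ω (φ ν) ^ 2) ∧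
      0 < ∑' ν, integralFunctional ω (φ ν) ^ 2 := by
  have hsum : Summable fun ν => integralFunctional ω (φ ν) ^ 2 := by
    have := hs.orthonormal.inner_products_summable (x := l2 ω)
    refine this.congr fun ν => ?_
    rw [integralFunctional_eq_inner hs hω, Real.norm_eq_abs, sq_abs]
  refine ⟨hsum, ?_⟩
  obtain ⟨ν, hν⟩ : ∃ ν, integralFunctional ω (φ ν) ≠ 0 := by
    by_contra! hcon
    have h1 : l2 ω = 0 := hc _ fun ν => by rw [← integralFunctional_eq_inner hs hω, hcon]
    have h2 := coeFn_l2 hω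
    rw [h1] at h2
    exact h0 (h2.symm.trans (Lp.coeFn_zero _ _ _))
  exact hsum.tsum_pos (fun _ => sq_nonneg _) ν (by positivity)

end Rates

end SplineBvM

theorem mainTheorem8
    -- the model: Gaussian regression with uniform covariate, truth `f₀ ∈ S²([0,1])`
    (A : ℝ → ℝ) (c : ℝ → ℝ → ℝ) (dens f₀ : ℝ → ℝ)
    (hA : SplineBvM.IsGaussianRegression 2 A c)
    (hdens : SplineBvM.IsUniformDensity dens)
    (hf₀ : SplineBvM.IsSobolev 2 f₀)
    -- the prior: `β > 1` and fixed positive variances `σ₁², σ₂²`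
    (β : ℝ) (hβ : 1 < β) (sigSq : ℕ → ℝ) (hsig : ∀ ν < 2, 0 < sigSq ν)
    -- the smoothing parameter: `h = λ^{1/4} ≍ n^{-1/(4+β)}`
    (lam : ℕ → ℝ) (hlam : ∀ n : ℕ, 1 ≤ n → 0 < lam n)
    (hh : SplineBvM.bandwidth 2 lam
      =Θ[atTop] (fun n : ℕ => (n : ℝ) ^ (-(1 / (2 * 2 + β))))) :
    (∃ (φ : ℕ → ℝ → ℝ) (ρ : ℕ → ℝ), SplineBvM.IsEigenSystem 2 A f₀ dens φ ρ) ∧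
    ∀ (φ : ℕ → ℝ → ℝ) (ρ : ℕ → ℝ), SplineBvM.IsEigenSystem 2 A f₀ dens φ ρ →
      (∀ z ∈ Ioo (0 : ℝ) 1,
        SplineBvM.RateCondition 2 β sigSq lam φ ρ (SplineBvM.evalFunctional z) 1) ∧
      (∀ ω : ℝ → ℝ, MemLp ω 2 (volume.restrict (Icc (0 : ℝ) 1)) →
        ¬ (ω =ᵐ[volume.restrict (Icc (0 : ℝ) 1)] 0) →
        (Summable (fun ν => SplineBvM.integralFunctional ω (φ ν) ^ 2) ∧
          0 < ∑' ν, SplineBvM.integralFunctional ω (φ ν) ^ 2) ∧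
        SplineBvM.RateCondition 2 β sigSq lam φ ρ (SplineBvM.integralFunctional ω) 0) := by
  have hA2 := hA.iteratedDeriv_two_eq_one
  refine ⟨SplineBvM.exists_isEigenSystem hA2 hdens, fun φ ρ h => ?_⟩
  obtain ⟨⟨φ₁, φ₂, φ₃, hs⟩, hc⟩ := h.exists_isBeamSystem hA2 hdens
  refine ⟨fun z hz => SplineBvM.rateCondition_eval hs hc hβ hsig hlam hh
    (Ioo_subset_Icc_self hz), fun ω hω h0 => ?_⟩
  have hF := SplineBvM.summable_integralFunctional hs hc hω h0
  exact ⟨hF, SplineBvM.rateCondition_zero hsig hs.nonneg hlam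
    (SplineBvM.tendsto_bandwidth hβ hh) hF.1 hF.2⟩
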